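/- Let $\mathbb{K}$ be a field and let $R=\bigoplus_{t\ge 0}R_t$ be a reduced standard graded $\mathbb{K}$-algebra, i.e. $R_0=\mathbb{K}$, $\dim_{\mathbb{K}}R_1<\infty$, and $R$ is generated by $R_1$ as a $\mathbb{K}$-algebra. For a standard graded $\mathbb{K}$-algebra $A$ of Krull dimension $d$ and a finitely generated graded $A$-module $M$, put $$e_A(M)=\lim_{t\to\infty}\frac{d!\,\sum_{i=0}^{t}\dim_{\mathbb{K}}[M]_i}{t^{d}}$$ (so $e_A(M)=0$ if $\dim M<d$), and write $e(M)=e_R(M)$. For integers $t,\ell\ge 1$ let $\mathcal{F}_{t,\ell}$ be the set of all $F=\{f_1,\dots,f_\ell\}\subseteq R_t$ such that $f_1,\dots,f_\ell$ are $\mathbb{K}$-linearly independent and $\mathrm{Ann}_R(F)\neq 0$. The generalized minimum distance function is $$\delta_R(t,\ell)=\begin{cases}e(R)-\max\{e(R/(F)) : F\in\mathcal{F}_{t,\ell}\} & \text{if }\mathcal{F}_{t,\ell}\ne\varnothing,\\ e(R)&\text{if }\mathcal{F}_{t,\ell}=\varnothing,\end{cases}$$ and the stabilization value is $s_R(\ell)=\lim_{t\to\infty}\delta_R(t,\ell)$.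 Call $R$ unmixed if $\dim(R/\mathfrak{P})$ is the same for all associated primes $\mathfrak{P}$ of $R$, and mixed otherwise. Let $\mathfrak{q}_1,\dots,\mathfrak{q}_a,\mathfrak{p}_1,\dots,\mathfrak{p}_b$ be the distinct minimal primes of $R$, where $\dim(R/\mathfrak{q}_i)=\dim(R)$ for all $i$, $\dim(R/\mathfrak{p}_j)<\dim(R)$ for all $j$, and $e(R/\mathfrak{q}_i)\le e(R/\mathfrak{q}_j)$ for $i\le j$. Let $T=R/\bigcap_{j=1}^{b}\mathfrak{p}_j$. Then for every $\ell\ge 1$ the function $t\mapsto\delta_R(t,\ell)$ is constant for $t\gg0$, and its stabilization value is given as follows. 1. If $R$ is mixed and $\dim(R/\mathfrak{p}_j)\ge 2$ for some $j$, then $s_R(\ell)=0$. 2. If $R$ is a domain, then $s_R(\ell)=e(R)$. 3. If $R$ is unmixed and $\dim(R)\ge 2$, then $s_R(\ell)=e(R/\mathfrak{q}_1)$. 4. If $\dim(R)=1$ and $\ell\le e(R)-e(R/\mathfrak{q}_1)$, then $$s_R(\ell)=\min\Big\{\sum_{i\in\sigma}e(R/\mathfrak{q}_i) : \sigma\subsetneq\{1,\dots,a\},\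 \ell\le\sum_{i\in\sigma}e(R/\mathfrak{q}_i)\Big\}.$$ 5. If $\dim(R)=1$ and $\ell>e(R)-e(R/\mathfrak{q}_1)$, then $s_R(\ell)=e(R)$. 6. If $R$ is mixed, $\dim(R/\mathfrak{p}_j)=1$ for all $j$, and $\ell\le e_T(T)$, then $s_R(\ell)=0$. 7. If $R$ is mixed, $\dim(R/\mathfrak{p}_j)=1$ for all $j$, and $\ell>e_T(T)$, then $s_R(\ell)=e(R/\mathfrak{q}_1)$. -/

import Mathlib

open Filter Topology

namespace GMD

variable {K : Type*} [Field K] {R : Type*} [CommRing R] [Algebra K R]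

/-- `R = ⨁ₜ 𝒜 t` is a standard graded `K`-algebra: `R₀ = K`, the space `R₁` of linear forms is
finite-dimensional, and `R₁` generates `R` as a `K`-algebra. -/
structure IsStandardGraded (𝒜 : ℕ → Submodule K R) [GradedAlgebra 𝒜] : Prop where
  algebraMap_injective : Function.Injective (algebraMap K R)
  zero_eq_one : 𝒜 0 = 1
  finite_one : Module.Finite K (𝒜 1)
  adjoin_one : Algebra.adjoin K (𝒜 1 : Set R) = ⊤

/-- The Krull dimension as a natural number (for nonzero rings of finite Krull dimension). -/
noncomputable def dim (A : Type*) [CommRing A] : ℕ :=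
  ((ringKrullDim A).unbotD 0).toNat

/-- The Hilbert function `h_M(t) = dim_K [M]_t` of a module `M` with graded pieces `𝓜 t`. -/
noncomputable def hilbertFunction {M : Type*} [AddCommGroup M] [Module K M]
    (𝓜 : ℕ → Submodule K M) (t : ℕ) : ℕ :=
  Module.finrank K (𝓜 t)

/-- The Hilbert-Samuel multiplicity `e_A(M)` of a graded module `M` (with graded pieces `𝓜 t`)
over the standard graded algebra `A`, namely `lim_t d! (∑_{i ≤ t} h_M(i)) / t ^ d` with
`d = dim A`. It is zero when `dim M < dim A`. -/
noncomputable def hsMultiplicity (A : Type*) [CommRing A] {M : Type*} [AddCommGroup M] [Module K M]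
    (𝓜 : ℕ → Submodule K M) : ℝ :=
  limUnder atTop fun t : ℕ =>
    ((dim A).factorial : ℝ) * (∑ i ∈ Finset.range (t + 1), (hilbertFunction 𝓜 i : ℝ))
      / (t : ℝ) ^ dim A

/-- The graded pieces `[R/I]_t` of the quotient of `R` by a homogeneous ideal `I`. -/
def quotientGrading (𝒜 : ℕ → Submodule K R) (I : Ideal R) (t : ℕ) : Submodule K (R ⧸ I) :=
  (𝒜 t).map (Ideal.Quotient.mkₐ K I).toLinearMap

/-- `e(R/I)`, the multiplicity of `R/I` as a graded `R`-module. -/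
noncomputable def multQuot (𝒜 : ℕ → Submodule K R) (I : Ideal R) : ℝ :=
  hsMultiplicity R (quotientGrading 𝒜 I)

/-- `e_T(T)` for the graded algebra `T = R/I`, that is, the multiplicity of `R/I` over itself. -/
noncomputable def multSelfQuot (𝒜 : ℕ → Submodule K R) (I : Ideal R) : ℝ :=
  hsMultiplicity (R ⧸ I) (quotientGrading 𝒜 I)

/-- The set `ℱ_{t,ℓ}` of families of `ℓ` forms of degree `t` that are linearly independent over
`K` and are annihilated by some nonzero element of `R`. -/
def formFamilies (𝒜 : ℕ → Submodule K R) (t ℓ : ℕ) : Set (Fin ℓ → R) :=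
  {f | (∀ i, f i ∈ 𝒜 t) ∧ LinearIndependent K f ∧
    (Ideal.span (Set.range f)).annihilator ≠ ⊥}

open Classical in
/-- The generalized minimum distance function `δ_R(t, ℓ)`. -/
noncomputable def gmd (𝒜 : ℕ → Submodule K R) (t ℓ : ℕ) : ℝ :=
  if (formFamilies 𝒜 t ℓ).Nonempty then
    hsMultiplicity R 𝒜 -
      sSup ((fun f : Fin ℓ → R => multQuot 𝒜 (Ideal.span (Set.range f))) '' formFamilies 𝒜 t ℓ)
  else hsMultiplicity R 𝒜

/-- The stabilization value `s_R(ℓ) = lim_t δ_R(t, ℓ)`. -/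
noncomputable def stabilizationValue (𝒜 : ℕ → Submodule K R) (ℓ : ℕ) : ℝ :=
  limUnder atTop fun t : ℕ => gmd 𝒜 t ℓ

/-- A ring is unmixed if all its associated primes have the same dimension, and is mixed
otherwise. -/
def IsUnmixed (A : Type*) [CommRing A] : Prop :=
  ∀ P ∈ associatedPrimes A A, ∀ Q ∈ associatedPrimes A A,
    ringKrullDim (A ⧸ P) = ringKrullDim (A ⧸ Q)

end GMD

/-!
The minimal primes of the reduced ring `R` are homogeneous and intersect in `0`, and a family `F` of
forms is annihilated by a nonzero element exactly when it lies in some minimal prime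
(`annihilator_ne_bot_iff`). For a homogeneous ideal `I`, let `J` be the intersection of the minimal
primes not containing `I`. Then `I ∩ J = 0`, while `I + J` lies in no minimal prime, so `R/(I + J)`
has smaller dimension than `R`; hence `e(R) - e(R/I) = e(R/J)`, and by the same additivity this is
the sum of `e(R/P)` over the minimal primes `P` not containing `I`
(`GMD.multQuot_add_sum_not_le`). Only the `q i` contribute. So `δ(t, ℓ)` is the least total
multiplicity of a set of components `q i` outside of which some admissible family of `ℓ` independent
forms of degree `t` vanishes, and the question becomes how many independent forms of degree `t` an
intersection `J` of minimal primes contains. If `J'` is the intersection of the other minimal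
primes, then `dim J_t = h_{R/J'}(t) - h_{R/(J + J')}(t)`. This number is unbounded when `J'` is a
prime of dimension at least two, and for `t ≫ 0` it equals the multiplicity of `R/J'` when `R/J'`
has dimension one. The listed values follow by choosing which components to leave out.

Two facts about multiplicities underlie this. The Hilbert function of a homogeneous quotient is
eventually polynomial (`GMD.exists_hilbertPolynomial`), by Noetherian induction on the ideal through
the sequence `0 → R/(I : x)(-1) → R/I → R/(I + (x)) → 0` for a linear form `x`. The degree of its
sum polynomial is `dim R/I` and the leading coefficient is positive
(`GMD.exists_cumHilbertPolynomial_natDegree_eq`), because by Noether normalization the filtration of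
a finitely generated algebra `A` by powers of a generating subspace has growth of order `t ^ dim A`
(`exists_ringKrullDim_eq_and_growth`). Thus the limits defining multiplicities exist, and `e(R/I)`
is positive exactly when `dim R/I = dim R`.
-/

/-! ### Krull dimension and growth of finitely generated algebras -/

/-- Integral extensions preserve the Krull dimension: chains of primes contract strictly
(incomparability) and lift (lying over and going up). -/
theorem ringKrullDim_eq_of_isIntegral_of_injective {A B : Type*} [CommRing A] [CommRing B]
    [Algebra A B] [Algebra.IsIntegral A B] (hinj : Function.Injective (algebraMap A B)) :
    ringKrullDim A = ringKrullDim B := by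
  apply le_antisymm
  · refine iSup_le fun l => ?_
    obtain ⟨Q, -, hQ, hQc⟩ := Ideal.exists_ideal_over_prime_of_isIntegral (S := B)
      l.head.asIdeal ⊥ (by
        rw [← RingHom.ker_eq_comap_bot, (RingHom.injective_iff_ker_eq_bot _).1 hinj]
        exact bot_le)
    have : Q.LiesOver l.head.asIdeal := ⟨hQc.symm⟩
    obtain ⟨L, hL, -, -⟩ := Ideal.exists_ltSeries_of_hasGoingUp (S := B) l Q
    rw [← hL]
    exact le_iSup (fun p : LTSeries (PrimeSpectrum B) => ((p.length : ℕ∞) : WithBot ℕ∞)) L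
  · refine Order.krullDim_le_of_strictMono (PrimeSpectrum.comap (algebraMap A B)) fun P Q h => ?_
    exact Ideal.IsIntegral.comap_lt_comap (R := A) (I := P.asIdeal) (J := Q.asIdeal) h

theorem MvPolynomial.finrank_restrictDegree (K : Type*) [Field K] (s k : ℕ) :
    Module.finrank K (MvPolynomial.restrictDegree (Fin s) K k) = (k + 1) ^ s := by
  rw [MvPolynomial.restrictDegree,
    Module.finrank_eq_nat_card_basis (MvPolynomial.basisRestrictSupport K _)]
  have e : {n : Fin s →₀ ℕ | ∀ i, n i ≤ k} ≃ (Fin s → Fin (k + 1)) :=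
    { toFun := fun n i => ⟨n.1 i, Nat.lt_succ_of_le (n.2 i)⟩
      invFun := fun f => ⟨Finsupp.equivFunOnFinite.symm fun i => (f i : ℕ), fun i =>
        Nat.le_of_lt_succ (f i).2⟩
      left_inv := fun n => by ext i; rfl
      right_inv := fun f => by ext i; rfl }
  rw [Nat.card_congr e]
  simp

theorem MvPolynomial.restrictDegree_mul_le (K : Type*) [Field K] (s k l : ℕ) :
    MvPolynomial.restrictDegree (Fin s) K k * MvPolynomial.restrictDegree (Fin s) K l ≤
      MvPolynomial.restrictDegree (Fin s) K (k + l) := by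
  classical
  refine Submodule.mul_le.2 fun p hp q hq => ?_
  rw [MvPolynomial.mem_restrictDegree] at hp hq ⊢
  intro n hn i
  obtain ⟨x, hx, y, hy, rfl⟩ := Finset.mem_add.1 (MvPolynomial.support_mul p q hn)
  exact add_le_add (hp x hx i) (hq y hy i)

theorem Submodule.exists_le_of_fg_of_monotone {K M : Type*} [Semiring K] [AddCommMonoid M]
    [Module K M] {F : ℕ → Submodule K M} (hF : Monotone F) (hcov : ∀ x, ∃ n, x ∈ F n)
    {W : Submodule K M} (hW : W.FG) : ∃ n, W ≤ F n := by
  obtain ⟨S, rfl⟩ := hW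
  choose n hn using hcov
  exact ⟨S.sup n, Submodule.span_le.2 fun x hx => hF (Finset.le_sup hx) (hn x)⟩

theorem Submodule.finrank_mul_le_finrank_mul_finrank {K A : Type*} [Field K] [CommRing A]
    [Algebra K A] (M N : Submodule K A) [Module.Finite K M] [Module.Finite K N] :
    Module.finrank K (M * N : Submodule K A) ≤ Module.finrank K M * Module.finrank K N := by
  rw [← Submodule.mulMap_range, ← Module.finrank_tensorProduct]
  exact LinearMap.finrank_range_le _

section Growth

variable {K A : Type*} [Field K] [CommRing A] [Algebra K A]

theorem Submodule.exists_mem_pow_of_adjoin_eq_top {V : Submodule K A} (hV1 : 1 ≤ V)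
    (hV : Algebra.adjoin K (V : Set A) = ⊤) (x : A) : ∃ n, x ∈ V ^ n := by
  have hx : x ∈ Algebra.adjoin K (V : Set A) := hV ▸ trivial
  have mono : Monotone fun n : ℕ => V ^ n := fun m n h => pow_le_pow_right₀ hV1 h
  induction hx using Algebra.adjoin_induction with
  | mem y hy => exact ⟨1, by simpa using hy⟩
  | algebraMap r => exact ⟨0, by simp⟩
  | add y z _ _ hy hz =>
    obtain ⟨m, hm⟩ := hy
    obtain ⟨n, hn⟩ := hz
    exact ⟨max m n, add_mem (mono (le_max_left _ _) hm) (mono (le_max_right _ _) hn)⟩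
  | mul y z _ _ hy hz =>
    obtain ⟨m, hm⟩ := hy
    obtain ⟨n, hn⟩ := hz
    exact ⟨m + n, pow_add V m n ▸ Submodule.mul_mem_mul hm hn⟩

/-- If `K[X₁, …, X_s] → A` is finite, the filtration of `A` by the powers of a finite-dimensional
subspace grows at most like `t ^ s`. -/
theorem exists_finrank_pow_le_of_finite {s : ℕ} {g : MvPolynomial (Fin s) K →ₐ[K] A}
    (hfin : g.Finite) {V : Submodule K A} (hVfg : V.FG) :
    ∃ C : ℕ, ∀ t : ℕ, 1 ≤ t → Module.finrank K (V ^ t : Submodule K A) ≤ C * t ^ s := by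
  classical
  let B : ℕ → Submodule K A := fun k => (MvPolynomial.restrictDegree (Fin s) K k).map g.toLinearMap
  have hBmono : Monotone B := fun k l h => Submodule.map_mono fun p hp => by
    rw [MvPolynomial.mem_restrictDegree] at hp ⊢
    exact fun n hn i => (hp n hn i).trans h
  have hBmul : ∀ k l, B k * B l ≤ B (k + l) := fun k l => by
    rw [← Submodule.map_mul]
    exact Submodule.map_mono (MvPolynomial.restrictDegree_mul_le K s k l)
  have hBfin : ∀ k, Module.finrank K (B k) ≤ (k + 1) ^ s := fun k =>
    (Submodule.finrank_map_le _ _).trans (MvPolynomial.finrank_restrictDegree K s k).le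
  obtain ⟨S, hS⟩ : ∃ S : Finset A, ∀ a, ∃ c : A → MvPolynomial (Fin s) K,
      a = ∑ x ∈ S, g (c x) * x := by
    let _ := g.toRingHom.toAlgebra
    obtain ⟨S, hS⟩ := (show Module.Finite (MvPolynomial (Fin s) K) A from hfin).fg_top
    refine ⟨S, fun a => ?_⟩
    have ha : a ∈ Submodule.span (MvPolynomial (Fin s) K) (S : Set A) := hS ▸ trivial
    obtain ⟨c, -, hc⟩ := Submodule.mem_span_finset.1 ha
    exact ⟨c, hc.symm⟩
  -- `U` spans `A` over the polynomial ring, and `A` is the union of the subspaces `B k * U`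
  let U : Submodule K A := Submodule.span K S
  have hUfg : U.FG := ⟨S, rfl⟩
  have hFmono : Monotone fun k => B k * U := fun k l h => mul_le_mul_left (hBmono h) U
  have hcov : ∀ x, ∃ k, x ∈ B k * U := by
    intro a
    obtain ⟨c, hc⟩ := hS a
    have hdeg : ∀ p : MvPolynomial (Fin s) K, p ∈ MvPolynomial.restrictDegree (Fin s) K
        p.totalDegree := fun p =>
      MvPolynomial.restrictTotalDegree_le_restrictDegree _ _ _
        ((MvPolynomial.mem_restrictTotalDegree _ _ _).2 le_rfl)
    refine ⟨S.sup fun x => (c x).totalDegree, ?_⟩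
    rw [hc]
    refine sum_mem fun x hx => Submodule.mul_mem_mul ?_ (Submodule.subset_span hx)
    exact hBmono (Finset.le_sup (f := fun x => (c x).totalDegree) hx)
      (Submodule.mem_map_of_mem (hdeg (c x)))
  -- `E` bounds the degrees of the coefficients in the multiplication table of `V` on `U`
  obtain ⟨E, hE⟩ := Submodule.exists_le_of_fg_of_monotone hFmono hcov (hVfg.mul hUfg)
  obtain ⟨E₀, hE₀⟩ := hcov 1
  have hpow : ∀ t, V ^ t * U ≤ B (t * E) * U := by
    intro t
    induction t with
    | zero =>
      rw [pow_zero, one_mul]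
      intro x hx
      rw [← one_mul x]
      refine Submodule.mul_mem_mul ⟨1, ?_, by simp⟩ hx
      rw [SetLike.mem_coe, MvPolynomial.mem_restrictDegree]
      intro n hn i
      rw [← MvPolynomial.C_1, MvPolynomial.mem_support_iff, MvPolynomial.coeff_C] at hn
      have : 0 = n := by
        by_contra h
        simp [h] at hn
      simp [← this]
    | succ t ih =>
      calc V ^ (t + 1) * U = V ^ t * (V * U) := by rw [pow_succ, mul_assoc]
        _ ≤ V ^ t * (B E * U) := mul_le_mul_right hE _
        _ = B E * (V ^ t * U) := by rw [← mul_assoc, mul_comm (V ^ t), mul_assoc]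
        _ ≤ B E * (B (t * E) * U) := mul_le_mul_right ih _
        _ = (B E * B (t * E)) * U := by rw [mul_assoc]
        _ ≤ B ((t + 1) * E) * U := mul_le_mul_left ((hBmul _ _).trans_eq (by ring_nf)) _
  have hle : ∀ t, V ^ t ≤ B (E₀ + t * E) * U := fun t =>
    calc V ^ t = V ^ t * 1 := (mul_one _).symm
      _ ≤ V ^ t * (B E₀ * U) := mul_le_mul_right (Submodule.one_le.2 hE₀) _
      _ = B E₀ * (V ^ t * U) := by rw [← mul_assoc, mul_comm (V ^ t), mul_assoc]
      _ ≤ B E₀ * (B (t * E) * U) := mul_le_mul_right (hpow t) _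
      _ = (B E₀ * B (t * E)) * U := by rw [mul_assoc]
      _ ≤ B (E₀ + t * E) * U := mul_le_mul_left (hBmul _ _) _
  have : Module.Finite K U := Module.Finite.iff_fg.2 hUfg
  refine ⟨(E₀ + 1 + E) ^ s * Module.finrank K U, fun t ht => ?_⟩
  have hBU : Module.Finite K (B (E₀ + t * E) * U : Submodule K A) :=
    Module.Finite.iff_fg.2 ((Module.Finite.iff_fg.1 inferInstance).mul hUfg)
  calc Module.finrank K (V ^ t : Submodule K A)
      ≤ Module.finrank K (B (E₀ + t * E) * U : Submodule K A) := Submodule.finrank_mono (hle t)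
    _ ≤ (E₀ + t * E + 1) ^ s * Module.finrank K U :=
      (Submodule.finrank_mul_le_finrank_mul_finrank _ _).trans (Nat.mul_le_mul_right _ (hBfin _))
    _ ≤ ((E₀ + 1 + E) * t) ^ s * Module.finrank K U := by
      refine Nat.mul_le_mul_right _ (Nat.pow_le_pow_left ?_ s)
      nlinarith
    _ = (E₀ + 1 + E) ^ s * Module.finrank K U * t ^ s := by rw [mul_pow]; ring

/-- If `K[X₁, …, X_s]` embeds into `A`, the filtration of `A` by the powers of a generating
subspace grows at least like `t ^ s`. -/
theorem exists_le_finrank_pow_of_injective {s : ℕ} {g : MvPolynomial (Fin s) K →ₐ[K] A}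
    (hinj : Function.Injective g) {V : Submodule K A} (hVfg : V.FG) (hV1 : 1 ≤ V)
    (hV : Algebra.adjoin K (V : Set A) = ⊤) :
    ∃ N : ℕ, ∀ t : ℕ, t ^ s ≤ (N + 1) ^ s * Module.finrank K (V ^ t : Submodule K A) := by
  have mono : Monotone fun n : ℕ => V ^ n := fun m n h => pow_le_pow_right₀ hV1 h
  choose n hn using fun i : Fin s => Submodule.exists_mem_pow_of_adjoin_eq_top hV1 hV
    (g (MvPolynomial.X i))
  let N := Finset.univ.sup n
  have hN : ∀ i, g (MvPolynomial.X i) ∈ V ^ N := fun i =>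
    mono (Finset.le_sup (f := n) (Finset.mem_univ i)) (hn i)
  have hB : ∀ k, (MvPolynomial.restrictDegree (Fin s) K k).map g.toLinearMap ≤
      V ^ (N * (s * k)) := by
    intro k
    rw [MvPolynomial.restrictDegree, MvPolynomial.restrictSupport_eq_span, Submodule.map_span,
      Submodule.span_le]
    rintro _ ⟨_, ⟨m, hm, rfl⟩, rfl⟩
    have hprod : g (MvPolynomial.monomial m 1) = ∏ i, g (MvPolynomial.X i) ^ m i := by
      rw [MvPolynomial.monomial_eq, Finsupp.prod_fintype _ _ (by simp)]
      simp
    have hmem : ∀ S : Finset (Fin s),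
        ∏ i ∈ S, g (MvPolynomial.X i) ^ m i ∈ V ^ (N * ∑ i ∈ S, m i) := by
      intro S
      induction S using Finset.cons_induction with
      | empty => simpa using ⟨1, map_one _⟩
      | cons i S hi ih =>
        rw [Finset.prod_cons, Finset.sum_cons, mul_add, pow_add, pow_mul]
        exact Submodule.mul_mem_mul (Submodule.pow_mem_pow _ (hN i) _) ih
    have hmem := hprod ▸ hmem Finset.univ
    refine mono (Nat.mul_le_mul_left N ?_) hmem
    calc ∑ i, m i ≤ ∑ _i : Fin s, k := Finset.sum_le_sum fun i _ => hm i
      _ = s * k := by simp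
  refine ⟨N * s, fun t => ?_⟩
  -- monomials with all exponents at most `t / (N s + 1)` map into `V ^ t`
  set k := t / (N * s + 1)
  have hk : N * (s * k) ≤ t :=
    calc N * (s * k) ≤ (N * s + 1) * k := by nlinarith
      _ ≤ t := Nat.mul_div_le _ _
  have : Module.Finite K (V ^ t : Submodule K A) := Module.Finite.iff_fg.2 (hVfg.pow t)
  have h1 : (k + 1) ^ s ≤ Module.finrank K (V ^ t : Submodule K A) := by
    rw [← MvPolynomial.finrank_restrictDegree K s k,
      (Submodule.equivMapOfInjective g.toLinearMap hinj _).finrank_eq]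
    exact Submodule.finrank_mono ((hB k).trans (mono hk))
  calc t ^ s ≤ ((N * s + 1) * (k + 1)) ^ s :=
        Nat.pow_le_pow_left (Nat.lt_mul_div_succ t (by positivity)).le s
    _ = (N * s + 1) ^ s * (k + 1) ^ s := mul_pow _ _ _
    _ ≤ _ := Nat.mul_le_mul_left _ h1

/-- The Krull dimension of a finitely generated algebra is the exponent with which the filtration
by powers of a finite-dimensional generating subspace grows. Noether normalization reduces this
to a polynomial ring. -/
theorem exists_ringKrullDim_eq_and_growth [Nontrivial A] {V : Submodule K A} (hVfg : V.FG)
    (hV1 : 1 ≤ V) (hV : Algebra.adjoin K (V : Set A) = ⊤) :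
    ∃ D : ℕ, ringKrullDim A = D ∧ ∃ c C : ℝ, 0 < c ∧ ∀ t : ℕ, 1 ≤ t →
      c * (t : ℝ) ^ D ≤ Module.finrank K (V ^ t : Submodule K A) ∧
      (Module.finrank K (V ^ t : Submodule K A) : ℝ) ≤ C * (t : ℝ) ^ D := by
  have : Algebra.FiniteType K A := by
    obtain ⟨S, hS⟩ := hVfg
    refine ⟨⟨S, ?_⟩⟩
    rw [← Algebra.adjoin_span, hS, hV]
  obtain ⟨s, g, hinj, hfin⟩ := exists_finite_inj_algHom_of_fg K A
  have hdim : ringKrullDim A = s := by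
    let _ := g.toRingHom.toAlgebra
    have : Module.Finite (MvPolynomial (Fin s) K) A := hfin
    rw [← ringKrullDim_eq_of_isIntegral_of_injective (A := MvPolynomial (Fin s) K) (B := A) hinj,
      MvPolynomial.ringKrullDim_of_isNoetherianRing, ringKrullDim_eq_zero_of_field]
    simp
  obtain ⟨C, hC⟩ := exists_finrank_pow_le_of_finite hfin hVfg
  obtain ⟨N, hN⟩ := exists_le_finrank_pow_of_injective hinj hVfg hV1 hV
  refine ⟨s, hdim, 1 / ((N : ℝ) + 1) ^ s, C, by positivity, fun t ht => ⟨?_, ?_⟩⟩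
  · rw [one_div, inv_mul_le_iff₀ (by positivity)]
    exact_mod_cast hN t
  · exact_mod_cast hC t ht

end Growth

/-! ### Hilbert functions of homogeneous quotients -/

theorem Submodule.finrank_map_add_finrank_inf_ker {K M N : Type*} [Field K] [AddCommGroup M]
    [Module K M] [AddCommGroup N] [Module K N] (f : M →ₗ[K] N) (W : Submodule K M)
    [Module.Finite K W] :
    Module.finrank K (W.map f) + Module.finrank K (W ⊓ LinearMap.ker f : Submodule K M) =
      Module.finrank K W := by
  have h := LinearMap.finrank_range_add_finrank_ker (f.domRestrict W)
  rw [LinearMap.range_domRestrict, LinearMap.ker_domRestrict] at h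
  rw [← h, ← Submodule.map_comap_subtype]
  congr 1
  exact (Submodule.equivMapOfInjective W.subtype W.subtype_injective _).finrank_eq.symm

namespace GMD

variable {K : Type*} [Field K] {R : Type*} [CommRing R] [Algebra K R]
  {𝒜 : ℕ → Submodule K R} [GradedAlgebra 𝒜]

theorem IsStandardGraded.one_pow_eq (hstd : IsStandardGraded 𝒜) (n : ℕ) : 𝒜 1 ^ n = 𝒜 n := by
  have hle : ∀ n, 𝒜 1 ^ n ≤ 𝒜 n := by
    intro n
    induction n with
    | zero => rw [pow_zero, hstd.zero_eq_one]
    | succ n ih =>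
      rw [pow_succ]
      exact Submodule.mul_le.2 fun x hx y hy => SetLike.mul_mem_graded (ih hx) hy
  refine le_antisymm (hle n) fun x hx => ?_
  have hproj : ∀ y : R, ∀ i, (DirectSum.decompose 𝒜 y i : R) ∈ 𝒜 1 ^ i := by
    intro y i
    have hy : y ∈ Submodule.span K (Submonoid.closure (𝒜 1 : Set R) : Set R) := by
      rw [← Algebra.adjoin_eq_span, hstd.adjoin_one]
      trivial
    induction hy using Submodule.span_induction with
    | zero => simp
    | add a b _ _ ha hb =>
      rw [DirectSum.decompose_add, DirectSum.add_apply, Submodule.coe_add]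
      exact add_mem ha hb
    | smul c a _ ha =>
      rw [DirectSum.decompose_smul, DirectSum.smul_apply, Submodule.coe_smul]
      exact Submodule.smul_mem _ c ha
    | mem a ha =>
      have : ∃ m, a ∈ 𝒜 1 ^ m := by
        induction ha using Submonoid.closure_induction with
        | mem z hz => exact ⟨1, by simpa using hz⟩
        | one => exact ⟨0, by simpa using ⟨1, map_one _⟩⟩
        | mul z w _ _ hz hw =>
          obtain ⟨m, hm⟩ := hz
          obtain ⟨k, hk⟩ := hw
          exact ⟨m + k, pow_add (𝒜 1) m k ▸ Submodule.mul_mem_mul hm hk⟩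
      obtain ⟨m, hm⟩ := this
      by_cases hmi : m = i
      · subst hmi
        rwa [DirectSum.decompose_of_mem_same 𝒜 (hle m hm)]
      · rw [DirectSum.decompose_of_mem_ne 𝒜 (hle m hm) hmi]
        exact zero_mem _
  have := hproj x n
  rwa [DirectSum.decompose_of_mem_same 𝒜 hx] at this

theorem IsStandardGraded.finite (hstd : IsStandardGraded 𝒜) (n : ℕ) : Module.Finite K (𝒜 n) := by
  rw [← hstd.one_pow_eq n, Module.Finite.iff_fg]
  exact (Module.Finite.iff_fg.1 hstd.finite_one).pow n

theorem IsStandardGraded.isNoetherianRing (hstd : IsStandardGraded 𝒜) : IsNoetherianRing R := by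
  have : Algebra.FiniteType K R := by
    obtain ⟨S, hS⟩ := Module.Finite.iff_fg.1 hstd.finite_one
    refine ⟨⟨S, ?_⟩⟩
    rw [← Algebra.adjoin_span, hS, hstd.adjoin_one]
  exact Algebra.FiniteType.isNoetherianRing K R

theorem IsStandardGraded.nontrivial (hstd : IsStandardGraded 𝒜) : Nontrivial R :=
  hstd.algebraMap_injective.nontrivial

/-- The forms of degree at most `t` are the `t`-th power of the space spanned by `1` and the
linear forms. -/
theorem IsStandardGraded.one_sup_pow_succ (hstd : IsStandardGraded 𝒜) (t : ℕ) :
    (1 ⊔ 𝒜 1) ^ (t + 1) = (1 ⊔ 𝒜 1) ^ t ⊔ 𝒜 (t + 1) := by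
  have h1 : (1 : Submodule K R) ≤ 1 ⊔ 𝒜 1 := le_sup_left
  apply le_antisymm
  · induction t with
    | zero => simp
    | succ t ih =>
      calc (1 ⊔ 𝒜 1) ^ (t + 1 + 1) = (1 ⊔ 𝒜 1) ^ (t + 1) * (1 ⊔ 𝒜 1) := pow_succ _ _
        _ = (1 ⊔ 𝒜 1) ^ (t + 1) ⊔ (1 ⊔ 𝒜 1) ^ (t + 1) * 𝒜 1 := by rw [Submodule.mul_sup, mul_one]
        _ ≤ (1 ⊔ 𝒜 1) ^ (t + 1) ⊔ ((1 ⊔ 𝒜 1) ^ t ⊔ 𝒜 (t + 1)) * 𝒜 1 :=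
          sup_le_sup_left (mul_le_mul_left ih _) _
        _ ≤ _ := by
          rw [Submodule.sup_mul]
          refine sup_le le_sup_left (sup_le (le_sup_of_le_left ?_) (le_sup_of_le_right ?_))
          · rw [pow_succ]
            exact mul_le_mul_right le_sup_right _
          · exact Submodule.mul_le.2 fun x hx y hy => SetLike.mul_mem_graded hx hy
  · refine sup_le (pow_le_pow_right₀ h1 t.le_succ) ?_
    rw [← hstd.one_pow_eq]
    exact pow_le_pow_left' le_sup_right _

theorem IsStandardGraded.decompose_eq_zero_of_mem_pow (hstd : IsStandardGraded 𝒜) {t : ℕ} {x : R}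
    (hx : x ∈ (1 ⊔ 𝒜 1) ^ t) {j : ℕ} (hj : t < j) : (DirectSum.decompose 𝒜 x j : R) = 0 := by
  induction t generalizing x with
  | zero =>
    rw [pow_zero, ← hstd.zero_eq_one] at hx
    exact DirectSum.decompose_of_mem_ne 𝒜 hx hj.ne
  | succ t ih =>
    rw [hstd.one_sup_pow_succ] at hx
    obtain ⟨y, hy, z, hz, rfl⟩ := Submodule.mem_sup.1 hx
    rw [DirectSum.decompose_add, DirectSum.add_apply, Submodule.coe_add,
      ih hy (t.lt_succ_self.trans hj), DirectSum.decompose_of_mem_ne 𝒜 hz hj.ne, add_zero]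

/-- The space of forms of degree `t` in an ideal. -/
def idealPiece (𝒜 : ℕ → Submodule K R) (I : Ideal R) (t : ℕ) : Submodule K R :=
  𝒜 t ⊓ I.restrictScalars K

theorem ker_mkₐ_toLinearMap (I : Ideal R) :
    LinearMap.ker (Ideal.Quotient.mkₐ K I).toLinearMap = I.restrictScalars K := by
  ext x
  simp [Ideal.Quotient.eq_zero_iff_mem]

theorem hilbertFunction_add_finrank_idealPiece (hstd : IsStandardGraded 𝒜) (I : Ideal R) (t : ℕ) :
    hilbertFunction (quotientGrading 𝒜 I) t + Module.finrank K (idealPiece 𝒜 I t) =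
      Module.finrank K (𝒜 t) := by
  have := hstd.finite t
  rw [idealPiece, ← ker_mkₐ_toLinearMap]
  exact Submodule.finrank_map_add_finrank_inf_ker _ _

theorem hilbertFunction_inf_add_sup (hstd : IsStandardGraded 𝒜) {I J : Ideal R} (hI : I.IsHomogeneous 𝒜)
    (hJ : J.IsHomogeneous 𝒜) (t : ℕ) :
    hilbertFunction (quotientGrading 𝒜 (I ⊓ J)) t + hilbertFunction (quotientGrading 𝒜 (I ⊔ J)) t =
      hilbertFunction (quotientGrading 𝒜 I) t + hilbertFunction (quotientGrading 𝒜 J) t := by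
  have := hstd.finite t
  have hsup : idealPiece 𝒜 (I ⊔ J) t = idealPiece 𝒜 I t ⊔ idealPiece 𝒜 J t := by
    apply le_antisymm
    · rintro x ⟨hx, hxs⟩
      obtain ⟨y, hy, z, hz, hyz⟩ := Submodule.mem_sup.1 hxs
      rw [← DirectSum.decompose_of_mem_same 𝒜 hx, ← hyz, DirectSum.decompose_add,
        DirectSum.add_apply, Submodule.coe_add]
      exact Submodule.add_mem_sup ⟨Subtype.prop _, hI t hy⟩ ⟨Subtype.prop _, hJ t hz⟩
    · refine sup_le ?_ ?_
      · exact fun x hx => ⟨hx.1, Ideal.mem_sup_left hx.2⟩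
      · exact fun x hx => ⟨hx.1, Ideal.mem_sup_right hx.2⟩
  have hinf : idealPiece 𝒜 (I ⊓ J) t = idealPiece 𝒜 I t ⊓ idealPiece 𝒜 J t := by
    ext x
    simp only [idealPiece, Submodule.mem_inf, Submodule.restrictScalars_mem]
    tauto
  have hfI : Module.Finite K (idealPiece 𝒜 I t) := Submodule.finiteDimensional_inf_left _ _
  have hfJ : Module.Finite K (idealPiece 𝒜 J t) := Submodule.finiteDimensional_inf_left _ _
  have h := Submodule.finrank_sup_add_finrank_inf_eq (idealPiece 𝒜 I t) (idealPiece 𝒜 J t)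
  rw [← hsup, ← hinf] at h
  have h1 := hilbertFunction_add_finrank_idealPiece hstd I t
  have h2 := hilbertFunction_add_finrank_idealPiece hstd J t
  have h3 := hilbertFunction_add_finrank_idealPiece hstd (I ⊓ J) t
  have h4 := hilbertFunction_add_finrank_idealPiece hstd (I ⊔ J) t
  omega

/-- The transporter ideal `(I : x)`, as the kernel of `r ↦ x r` modulo `I`. -/
def transporter (I : Ideal R) (x : R) : Ideal R := Submodule.comap (LinearMap.lsmul R R x) I

theorem mem_transporter {I : Ideal R} {x r : R} : r ∈ transporter I x ↔ x * r ∈ I := Iff.rfl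

end GMD

/-! ### Eventually polynomial functions -/

namespace Polynomial

/-- Every real polynomial is a forward difference of a polynomial; on monomials, Bernoulli
polynomials are antidifferences. -/
theorem exists_eval_add_one_sub_eval_eq (p : ℝ[X]) :
    ∃ P : ℝ[X], ∀ t : ℕ, P.eval ((t : ℝ) + 1) - P.eval (t : ℝ) = p.eval (t : ℝ) := by
  induction p using Polynomial.induction_on' with
  | add p q hp hq =>
    obtain ⟨P, hP⟩ := hp
    obtain ⟨Q, hQ⟩ := hq
    exact ⟨P + Q, fun t => by rw [eval_add, eval_add, eval_add, ← hP, ← hQ]; ring⟩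
  | monomial n a =>
    have hcast : ∀ x : ℚ, ((bernoulli (n + 1)).map (algebraMap ℚ ℝ)).eval (x : ℝ) =
        (((bernoulli (n + 1)).eval x : ℚ) : ℝ) := fun x => by
      rw [← eq_ratCast (algebraMap ℚ ℝ), eval_map_apply, eq_ratCast]
    refine ⟨C (a / (n + 1)) * (bernoulli (n + 1)).map (algebraMap ℚ ℝ), fun t => ?_⟩
    have h := congrArg (fun x : ℚ => (x : ℝ)) (bernoulli_eval_one_add (n + 1) (t : ℚ))
    have h1 := hcast (1 + t)
    have h2 := hcast t
    push_cast at h h1 h2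
    rw [eval_mul, eval_mul, eval_C, eval_C, add_comm (t : ℝ) 1, h1, h2, h, eval_monomial]
    have : (n : ℝ) + 1 ≠ 0 := by positivity
    rw [← mul_sub, add_sub_cancel_left]
    field_simp

theorem exists_eventually_eq_of_sub_eventually_eq {f : ℕ → ℝ} {p : ℝ[X]}
    (h : ∀ᶠ t : ℕ in atTop, f (t + 1) - f t = p.eval (t : ℝ)) :
    ∃ P : ℝ[X], ∀ᶠ t : ℕ in atTop, f t = P.eval (t : ℝ) := by
  obtain ⟨P, hP⟩ := exists_eval_add_one_sub_eval_eq p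
  obtain ⟨N, hN⟩ := eventually_atTop.1 h
  refine ⟨P + C (f N - P.eval (N : ℝ)), eventually_atTop.2 ⟨N, fun t ht => ?_⟩⟩
  rw [eval_add, eval_C]
  induction t, ht using Nat.le_induction with
  | base => ring
  | succ t ht ih =>
    have h1 := hN t ht
    have h2 := hP t
    push_cast
    linarith

theorem natDegree_eq_and_leadingCoeff_pos_of_bounds {p : ℝ[X]} {D : ℕ} {c C : ℝ} (hc : 0 < c)
    (h : ∀ᶠ t : ℕ in atTop, c * (t : ℝ) ^ D ≤ p.eval (t : ℝ) ∧ p.eval (t : ℝ) ≤ C * (t : ℝ) ^ D) :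
    p.natDegree = D ∧ 0 < p.leadingCoeff := by
  have hq : ∀ᶠ t : ℕ in atTop, c ≤ p.eval (t : ℝ) / (X ^ D : ℝ[X]).eval (t : ℝ) ∧
      p.eval (t : ℝ) / (X ^ D : ℝ[X]).eval (t : ℝ) ≤ C := by
    filter_upwards [h, eventually_gt_atTop 0] with t ht ht0
    have : (0 : ℝ) < (t : ℝ) ^ D := by positivity
    rw [eval_pow, eval_X, le_div_iff₀ this, div_le_iff₀ this]
    exact ht
  have hcast := tendsto_natCast_atTop_atTop (R := ℝ)
  have hX : (X ^ D : ℝ[X]) ≠ 0 := pow_ne_zero _ X_ne_zero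
  have hdeg : p.degree = (X ^ D : ℝ[X]).degree := by
    rcases lt_trichotomy p.degree (X ^ D : ℝ[X]).degree with hlt | heq | hgt
    · have := (div_tendsto_atTop_zero_of_degree_lt p _ hlt).comp hcast
      exact absurd (ge_of_tendsto this (hq.mono fun t ht => ht.1)) (not_le.2 hc)
    · exact heq
    · have := (abs_div_tendsto_atTop_atTop_of_degree_gt p _ hgt hX).comp hcast
      obtain ⟨t, ht, ht1, ht2⟩ := ((this.eventually_gt_atTop (max C 0)).and hq).exists
      rw [Function.comp_apply, abs_of_nonneg (hc.le.trans ht1)] at ht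
      exact absurd ((le_max_left _ _).trans_lt ht) (not_lt.2 ht2)
  constructor
  · rw [natDegree_eq_of_degree_eq hdeg, natDegree_X_pow]
  · have := (div_tendsto_atTop_leadingCoeff_div_of_degree_eq p _ hdeg).comp hcast
    rw [leadingCoeff_X_pow, div_one] at this
    exact hc.trans_le (ge_of_tendsto this (hq.mono fun t ht => ht.1))

end Polynomial

/-! ### Hilbert polynomials -/

namespace GMD

variable {K : Type*} [Field K] {R : Type*} [CommRing R] [Algebra K R]
  {𝒜 : ℕ → Submodule K R} [GradedAlgebra 𝒜]

theorem isHomogeneous_transporter {I : Ideal R} (hI : I.IsHomogeneous 𝒜) {x : R} {k : ℕ}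
    (hx : x ∈ 𝒜 k) : (transporter I x).IsHomogeneous 𝒜 := by
  intro i r hr
  rw [mem_transporter] at hr ⊢
  rw [← DirectSum.coe_decompose_mul_add_of_left_mem 𝒜 hx]
  exact hI _ hr

/-- The short exact sequence `0 → R/(I : x)(-1) → R/I → R/(I + (x)) → 0` for a linear form `x`. -/
theorem hilbertFunction_succ (hstd : IsStandardGraded 𝒜) {I : Ideal R} (hI : I.IsHomogeneous 𝒜)
    {x : R} (hx : x ∈ 𝒜 1) (t : ℕ) :
    hilbertFunction (quotientGrading 𝒜 I) (t + 1) =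
      hilbertFunction (quotientGrading 𝒜 (transporter I x)) t +
        hilbertFunction (quotientGrading 𝒜 (I ⊔ Ideal.span {x})) (t + 1) := by
  have h0 := hstd.finite t
  have h1 := hstd.finite (t + 1)
  let φ : R →ₗ[K] R ⧸ I := (Ideal.Quotient.mkₐ K I).toLinearMap ∘ₗ LinearMap.mulLeft K x
  let ψ : R ⧸ I →ₐ[K] R ⧸ (I ⊔ Ideal.span {x}) := Ideal.Quotient.factorₐ K le_sup_left
  have hφ : Module.finrank K ((𝒜 t).map φ) =
      hilbertFunction (quotientGrading 𝒜 (transporter I x)) t := by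
    have hker : LinearMap.ker φ = (transporter I x).restrictScalars K := by
      ext r
      rw [LinearMap.mem_ker]
      exact Ideal.Quotient.eq_zero_iff_mem
    have e1 := Submodule.finrank_map_add_finrank_inf_ker φ (𝒜 t)
    have e2 := hilbertFunction_add_finrank_idealPiece hstd (transporter I x) t
    rw [hker] at e1
    rw [idealPiece] at e2
    omega
  have hψ : (quotientGrading 𝒜 I (t + 1)).map ψ.toLinearMap =
      quotientGrading 𝒜 (I ⊔ Ideal.span {x}) (t + 1) := by
    rw [quotientGrading, ← Submodule.map_comp]
    rfl
  have hinf : quotientGrading 𝒜 I (t + 1) ⊓ LinearMap.ker ψ.toLinearMap = (𝒜 t).map φ := by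
    apply le_antisymm
    · rintro _ ⟨⟨r, hr, rfl⟩, hk⟩
      have hr' : r ∈ I ⊔ Ideal.span {x} := by
        rw [← Ideal.Quotient.eq_zero_iff_mem]
        exact hk
      obtain ⟨y, hy, z, hz, hyz⟩ := Submodule.mem_sup.1 hr'
      obtain ⟨s, rfl⟩ := Ideal.mem_span_singleton'.1 hz
      refine ⟨DirectSum.decompose 𝒜 s t, Subtype.prop _, ?_⟩
      have hdec := DirectSum.decompose_of_mem_same 𝒜 hr
      rw [← hyz, DirectSum.decompose_add, DirectSum.add_apply, Submodule.coe_add, mul_comm s,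
        add_comm t, DirectSum.coe_decompose_mul_add_of_left_mem 𝒜 hx] at hdec
      have : x * (DirectSum.decompose 𝒜 s t : R) - r ∈ I := by
        rw [← hyz, mul_comm s, ← hdec, sub_add_cancel_right]
        exact I.neg_mem (hI _ hy)
      exact (Ideal.Quotient.mk_eq_mk_iff_sub_mem _ _).2 this
    · rintro _ ⟨r, hr, rfl⟩
      refine ⟨⟨x * r, ?_, rfl⟩, ?_⟩
      · rw [add_comm]
        exact SetLike.mul_mem_graded hx hr
      · show Ideal.Quotient.mk (I ⊔ Ideal.span {x}) (x * r) = 0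
        rw [Ideal.Quotient.eq_zero_iff_mem]
        exact Ideal.mem_sup_right (Ideal.mul_mem_right _ _ (Ideal.mem_span_singleton_self x))
  have : Module.Finite K (quotientGrading 𝒜 I (t + 1)) := Module.Finite.map _ _
  have h := Submodule.finrank_map_add_finrank_inf_ker ψ.toLinearMap (quotientGrading 𝒜 I (t + 1))
  rw [hψ, hinf, hφ] at h
  unfold hilbertFunction at h ⊢
  omega

/-- Hilbert functions of homogeneous quotients are eventually polynomial, by Noetherian induction
on the ideal. -/
theorem exists_hilbertPolynomial (hstd : IsStandardGraded 𝒜) {I : Ideal R}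
    (hI : I.IsHomogeneous 𝒜) :
    ∃ p : Polynomial ℝ, ∀ᶠ t : ℕ in atTop,
      (hilbertFunction (quotientGrading 𝒜 I) t : ℝ) = p.eval (t : ℝ) := by
  have := hstd.isNoetherianRing
  induction I using IsNoetherian.induction with
  | hgt I ih =>
  by_cases h1 : 𝒜 1 ≤ I.restrictScalars K
  · refine ⟨0, eventually_atTop.2 ⟨1, fun t ht => ?_⟩⟩
    obtain ⟨t, rfl⟩ := Nat.exists_eq_add_of_le' ht
    have hz : quotientGrading 𝒜 I (t + 1) = ⊥ := by
      rw [quotientGrading, eq_bot_iff, Submodule.map_le_iff_le_comap, Submodule.comap_bot,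
        ker_mkₐ_toLinearMap, ← hstd.one_pow_eq, pow_succ]
      exact Submodule.mul_le.2 fun y _ z hz => Ideal.mul_mem_left I y (h1 hz)
    rw [hilbertFunction, hz, finrank_bot]
    simp
  · obtain ⟨x, hx, hxI⟩ := SetLike.not_le_iff_exists.1 h1
    have hsup : I < I ⊔ Ideal.span {x} := by
      refine lt_of_le_not_ge le_sup_left fun h => hxI ?_
      exact h (Ideal.mem_sup_right (Ideal.mem_span_singleton_self x))
    have hsuph : (I ⊔ Ideal.span {x}).IsHomogeneous 𝒜 :=
      hI.sup (Ideal.homogeneous_span _ _ (by rintro _ rfl; exact ⟨1, hx⟩))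
    have hle : I ≤ transporter I x := fun r hr => Ideal.mul_mem_left I x hr
    obtain ⟨p, hp⟩ := ih _ hsup hsuph
    -- if `x` is a nonzerodivisor modulo `I`, the difference of the Hilbert function of `R/I` is
    -- eventually polynomial; otherwise both outer terms of the exact sequence are covered by `ih`
    by_cases heq : I = transporter I x
    · refine Polynomial.exists_eventually_eq_of_sub_eventually_eq
        (p := p.comp (Polynomial.X + Polynomial.C 1)) ?_
      filter_upwards [(tendsto_add_atTop_nat 1).eventually hp] with t ht
      rw [hilbertFunction_succ hstd hI hx t, ← heq]
      push_cast at ht ⊢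
      simp [ht]
    · obtain ⟨q, hq⟩ := ih _ (lt_of_le_of_ne hle heq) (isHomogeneous_transporter hI hx)
      refine ⟨q.comp (Polynomial.X - Polynomial.C 1) + p, ?_⟩
      filter_upwards [hp, (tendsto_sub_atTop_nat 1).eventually hq, eventually_ge_atTop 1]
        with t htp htq ht
      obtain ⟨t, rfl⟩ := Nat.exists_eq_add_of_le' ht
      rw [hilbertFunction_succ hstd hI hx t]
      rw [Nat.add_sub_cancel] at htq
      push_cast at htp ⊢
      simp [htp, htq]

/-- The cumulative Hilbert function of `R/I`. -/
noncomputable def cumHilbert (𝒜 : ℕ → Submodule K R) (I : Ideal R) (t : ℕ) : ℝ :=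
  ∑ i ∈ Finset.range (t + 1), (hilbertFunction (quotientGrading 𝒜 I) i : ℝ)

omit [GradedAlgebra 𝒜] in
theorem cumHilbert_succ (I : Ideal R) (t : ℕ) :
    cumHilbert 𝒜 I (t + 1) =
      cumHilbert 𝒜 I t + hilbertFunction (quotientGrading 𝒜 I) (t + 1) :=
  Finset.sum_range_succ _ _

theorem exists_cumHilbertPolynomial (hstd : IsStandardGraded 𝒜) {I : Ideal R}
    (hI : I.IsHomogeneous 𝒜) :
    ∃ p : Polynomial ℝ, ∀ᶠ t : ℕ in atTop, cumHilbert 𝒜 I t = p.eval (t : ℝ) := by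
  obtain ⟨p, hp⟩ := exists_hilbertPolynomial hstd hI
  refine Polynomial.exists_eventually_eq_of_sub_eventually_eq
    (p := p.comp (Polynomial.X + Polynomial.C 1)) ?_
  filter_upwards [(tendsto_add_atTop_nat 1).eventually hp] with t ht
  rw [cumHilbert_succ, ht]
  simp

/-- The cumulative Hilbert function of `R/I` at `t` is the dimension of the span of the products
of at most `t` linear forms. -/
theorem cumHilbert_eq_finrank_pow (hstd : IsStandardGraded 𝒜) {I : Ideal R}
    (hI : I.IsHomogeneous 𝒜) (t : ℕ) :
    cumHilbert 𝒜 I t = Module.finrank K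
      (((1 ⊔ 𝒜 1).map (Ideal.Quotient.mkₐ K I).toLinearMap) ^ t : Submodule K (R ⧸ I)) := by
  have hfg : (1 ⊔ 𝒜 1).FG := by
    have := hstd.finite 0
    have h1 := hstd.finite 1
    rw [← hstd.zero_eq_one]
    exact (Module.Finite.iff_fg.1 this).sup (Module.Finite.iff_fg.1 h1)
  rw [← Submodule.map_pow]
  induction t with
  | zero => 
    rw [pow_zero, ← hstd.zero_eq_one]
    simp [cumHilbert, hilbertFunction, quotientGrading]
    rfl
  | succ t ih =>
    rw [cumHilbert_succ, ih, hstd.one_sup_pow_succ, Submodule.map_sup]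
    have h1 := hstd.finite (t + 1)
    have h2 : Module.Finite K ((1 ⊔ 𝒜 1) ^ t : Submodule K R) :=
      Module.Finite.iff_fg.2 (hfg.pow t)
    have hd : ((1 ⊔ 𝒜 1) ^ t).map (Ideal.Quotient.mkₐ K I).toLinearMap ⊓
        (𝒜 (t + 1)).map (Ideal.Quotient.mkₐ K I).toLinearMap = ⊥ := by
      rw [eq_bot_iff]
      rintro _ ⟨⟨y, hy, rfl⟩, ⟨z, hz, hzy⟩⟩
      have hmem : z - y ∈ I := (Ideal.Quotient.mk_eq_mk_iff_sub_mem _ _).1 hzy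
      have := hI (t + 1) hmem
      rw [DirectSum.decompose_sub, DirectSum.sub_apply, Submodule.coe_sub,
        DirectSum.decompose_of_mem_same 𝒜 hz,
        hstd.decompose_eq_zero_of_mem_pow hy t.lt_succ_self, sub_zero] at this
      rw [← hzy]
      exact Ideal.Quotient.eq_zero_iff_mem.2 this
    have h := Submodule.finrank_sup_add_finrank_inf_eq
      (((1 ⊔ 𝒜 1) ^ t).map (Ideal.Quotient.mkₐ K I).toLinearMap)
      ((𝒜 (t + 1)).map (Ideal.Quotient.mkₐ K I).toLinearMap)
    rw [hd, finrank_bot, add_zero] at h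
    rw [h]
    push_cast
    rfl

/-- For a proper homogeneous ideal `I` the cumulative Hilbert function of `R/I` is eventually a
polynomial of degree `dim R/I` with positive leading coefficient. -/
theorem exists_cumHilbertPolynomial_natDegree_eq (hstd : IsStandardGraded 𝒜) {I : Ideal R}
    (hI : I.IsHomogeneous 𝒜) (hI' : I ≠ ⊤) :
    ∃ D : ℕ, ringKrullDim (R ⧸ I) = D ∧ ∃ p : Polynomial ℝ,
      (∀ᶠ t : ℕ in atTop, cumHilbert 𝒜 I t = p.eval (t : ℝ)) ∧ p.natDegree = D ∧
        0 < p.leadingCoeff := by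
  have : Nontrivial (R ⧸ I) := Ideal.Quotient.nontrivial_iff.2 hI'
  have hfg : ((1 ⊔ 𝒜 1).map (Ideal.Quotient.mkₐ K I).toLinearMap).FG := by
    have := hstd.finite 0
    have h1 := hstd.finite 1
    rw [← hstd.zero_eq_one]
    exact ((Module.Finite.iff_fg.1 this).sup (Module.Finite.iff_fg.1 h1)).map _
  obtain ⟨D, hD, c, C, hc, hb⟩ := exists_ringKrullDim_eq_and_growth hfg
    (by
      rw [Submodule.map_sup, Submodule.map_one]
      exact le_sup_left)
    (by
      rw [eq_top_iff]
      have h := congrArg (Subalgebra.map (Ideal.Quotient.mkₐ K I)) hstd.adjoin_one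
      rw [Algebra.map_top, (AlgHom.range_eq_top _).2 (Ideal.Quotient.mkₐ_surjective K I),
        AlgHom.map_adjoin] at h
      rw [← h]
      exact Algebra.adjoin_mono (Set.image_mono fun x hx => Submodule.mem_sup_right hx))
  obtain ⟨p, hp⟩ := exists_cumHilbertPolynomial hstd hI
  refine ⟨D, hD, p, hp, Polynomial.natDegree_eq_and_leadingCoeff_pos_of_bounds (C := C) hc ?_⟩
  filter_upwards [hp, eventually_ge_atTop 1] with t ht ht1
  rw [← ht, cumHilbert_eq_finrank_pow hstd hI]
  exact hb t ht1

end GMD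

/-! ### Dimensions of quotients -/

/-- The dimension of `R/I` is controlled by the primes containing `I`. -/
theorem ringKrullDim_quotient_lt_of_forall_prime {R : Type*} [CommRing R] {I : Ideal R} {n : ℕ}
    (h : ∀ Q : Ideal R, Q.IsPrime → I ≤ Q → ringKrullDim (R ⧸ Q) < n) :
    ringKrullDim (R ⧸ I) < n := by
  rw [ringKrullDim_quotient, Order.krullDim_lt_coe_iff]
  intro l
  have hl : ∀ i, l.head.1.asIdeal ≤ (l i).1.asIdeal := fun i => l.head_le i
  have hQ := h l.head.1.asIdeal l.head.1.isPrime l.head.2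
  rw [ringKrullDim_quotient, Order.krullDim_lt_coe_iff] at hQ
  exact hQ ⟨l.length, fun i => ⟨(l i).1, hl i⟩, l.step⟩

theorem ringKrullDim_quotient_lt_of_lt {R : Type*} [CommRing R] {P Q : Ideal R} [P.IsPrime]
    (hPQ : P < Q) {n : ℕ} (hn : ringKrullDim (R ⧸ P) ≤ n) : ringKrullDim (R ⧸ Q) < n := by
  obtain ⟨x, hxQ, hxP⟩ := SetLike.exists_of_lt hPQ
  have h : ringKrullDim (R ⧸ Q) + 1 ≤ ringKrullDim (R ⧸ P) := by
    refine ringKrullDim_succ_le_of_surjective (Ideal.Quotient.factor hPQ.le)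
      (Ideal.Quotient.factor_surjective hPQ.le) (r := Ideal.Quotient.mk P x) ?_ ?_
    · rw [mem_nonZeroDivisors_iff_ne_zero, ne_eq, Ideal.Quotient.eq_zero_iff_mem]
      exact hxP
    · rw [Ideal.Quotient.factor_mk, Ideal.Quotient.eq_zero_iff_mem]
      exact hxQ
  have h' := h.trans hn
  generalize ringKrullDim (R ⧸ Q) = e at h'
  induction e with
  | bot => exact WithBot.bot_lt_coe _
  | coe e =>
    have h2 : e + 1 ≤ (n : ℕ∞) := by exact_mod_cast h'
    have : e < (n : ℕ∞) := ENat.add_one_le_iff (fun h => by simp [h] at h2) |>.1 h2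
    exact_mod_cast this

namespace GMD

variable {K : Type*} [Field K] {R : Type*} [CommRing R] [Algebra K R]
  {𝒜 : ℕ → Submodule K R} [GradedAlgebra 𝒜]

/-! ### Multiplicities -/

theorem ringKrullDim_eq_dim {A : Type*} [CommRing A] {n : ℕ} (h : ringKrullDim A = n) :
    dim A = n := by
  rw [dim, h]
  rfl

omit [GradedAlgebra 𝒜] in
theorem cumHilbert_top (t : ℕ) : cumHilbert 𝒜 (⊤ : Ideal R) t = 0 := by
  have : Subsingleton (R ⧸ (⊤ : Ideal R)) := Ideal.Quotient.subsingleton_iff.2 rfl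
  refine Finset.sum_eq_zero fun i _ => ?_
  rw [hilbertFunction, Module.finrank_zero_of_subsingleton, Nat.cast_zero]

/-- Existence of the limit defining the multiplicity of `R/I`, normalized in any degree `d` at least
`dim R/I`. The unit ideal is allowed. -/
theorem exists_tendsto_cumHilbert (hstd : IsStandardGraded 𝒜) {I : Ideal R}
    (hI : I.IsHomogeneous 𝒜) {d : ℕ} (hd : ringKrullDim (R ⧸ I) ≤ d) :
    ∃ L : ℝ, Tendsto (fun t : ℕ => (d.factorial : ℝ) * cumHilbert 𝒜 I t / (t : ℝ) ^ d) atTop (𝓝 L) ∧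
      (ringKrullDim (R ⧸ I) < d → L = 0) ∧ (ringKrullDim (R ⧸ I) = d → 0 < L) := by
  by_cases htop : I = ⊤
  · subst htop
    have hbot : ringKrullDim (R ⧸ (⊤ : Ideal R)) = ⊥ := by
      have : Subsingleton (R ⧸ (⊤ : Ideal R)) := Ideal.Quotient.subsingleton_iff.2 rfl
      exact ringKrullDim_eq_bot_of_subsingleton
    refine ⟨0, by simp [cumHilbert_top], fun _ => rfl, fun h => ?_⟩
    rw [hbot] at h
    exact absurd h (WithBot.bot_ne_coe)
  obtain ⟨D, hD, p, hp, hpD, hlead⟩ := exists_cumHilbertPolynomial_natDegree_eq hstd hI htop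
  have hcast := tendsto_natCast_atTop_atTop (R := ℝ)
  have hp0 : p ≠ 0 := fun h => by simp [h] at hlead
  have hdeg : p.degree = D := by rw [Polynomial.degree_eq_natDegree hp0, hpD]
  have key : ∀ M : ℝ, Tendsto (fun t : ℕ => p.eval (t : ℝ) / (Polynomial.X ^ d : Polynomial ℝ).eval
      (t : ℝ)) atTop (𝓝 M) → Tendsto (fun t : ℕ => (d.factorial : ℝ) * cumHilbert 𝒜 I t /
        (t : ℝ) ^ d) atTop (𝓝 (d.factorial * M)) := by
    intro M hM
    refine (hM.const_mul (d.factorial : ℝ)).congr' ?_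
    filter_upwards [hp] with t ht
    rw [ht, Polynomial.eval_pow, Polynomial.eval_X, mul_div_assoc]
  rw [hD] at hd ⊢
  have hDd : D ≤ d := by exact_mod_cast hd
  rcases hDd.lt_or_eq with hlt | rfl
  · refine ⟨_, key 0 ((Polynomial.div_tendsto_atTop_zero_of_degree_lt p _ ?_).comp hcast),
      fun _ => mul_zero _, fun h => ?_⟩
    · rw [hdeg, Polynomial.degree_X_pow]
      exact_mod_cast hlt
    · exact absurd (by exact_mod_cast h) hlt.ne
  · refine ⟨_, key p.leadingCoeff ?_, fun h => absurd h (lt_irrefl _), fun _ => by positivity⟩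
    have := (Polynomial.div_tendsto_atTop_leadingCoeff_div_of_degree_eq p (Polynomial.X ^ D)
      (by rw [hdeg, Polynomial.degree_X_pow])).comp hcast
    rwa [Polynomial.leadingCoeff_X_pow, div_one] at this

omit [GradedAlgebra 𝒜] in
theorem multQuot_eq_of_tendsto {I : Ideal R} {L : ℝ} {d : ℕ} (hd : ringKrullDim R = d)
    (h : Tendsto (fun t : ℕ => (d.factorial : ℝ) * cumHilbert 𝒜 I t / (t : ℝ) ^ d) atTop (𝓝 L)) :
    multQuot 𝒜 I = L := by
  unfold multQuot hsMultiplicity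
  rw [ringKrullDim_eq_dim hd]
  exact h.limUnder_eq

omit [GradedAlgebra 𝒜] in
theorem multSelfQuot_eq_of_tendsto {I : Ideal R} {L : ℝ} {d : ℕ} (hd : ringKrullDim (R ⧸ I) = d)
    (h : Tendsto (fun t : ℕ => (d.factorial : ℝ) * cumHilbert 𝒜 I t / (t : ℝ) ^ d) atTop (𝓝 L)) :
    multSelfQuot 𝒜 I = L := by
  unfold multSelfQuot hsMultiplicity
  rw [ringKrullDim_eq_dim hd]
  exact h.limUnder_eq

theorem IsStandardGraded.exists_ringKrullDim_eq (hstd : IsStandardGraded 𝒜) {I : Ideal R}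
    (hI : I.IsHomogeneous 𝒜) (hI' : I ≠ ⊤) : ∃ D : ℕ, ringKrullDim (R ⧸ I) = D :=
  let ⟨D, hD, _⟩ := exists_cumHilbertPolynomial_natDegree_eq hstd hI hI'
  ⟨D, hD⟩

theorem ringKrullDim_quotient_bot : ringKrullDim (R ⧸ (⊥ : Ideal R)) = ringKrullDim R :=
  ringKrullDim_eq_of_ringEquiv (RingEquiv.quotientBot R)

theorem IsStandardGraded.ringKrullDim_eq (hstd : IsStandardGraded 𝒜) :
    ∃ d : ℕ, ringKrullDim R = d := by
  have := hstd.nontrivial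
  obtain ⟨d, hd⟩ := hstd.exists_ringKrullDim_eq (Ideal.IsHomogeneous.bot 𝒜) bot_ne_top
  exact ⟨d, by rw [← ringKrullDim_quotient_bot, hd]⟩

theorem tendsto_multQuot (hstd : IsStandardGraded 𝒜) {I : Ideal R} (hI : I.IsHomogeneous 𝒜) {d : ℕ}
    (hd : ringKrullDim R = d) :
    Tendsto (fun t : ℕ => (d.factorial : ℝ) * cumHilbert 𝒜 I t / (t : ℝ) ^ d) atTop
      (𝓝 (multQuot 𝒜 I)) := by
  obtain ⟨L, hL, -⟩ := exists_tendsto_cumHilbert hstd hI (hd ▸ ringKrullDim_quotient_le I)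
  rwa [multQuot_eq_of_tendsto hd hL]

theorem multQuot_eq_zero (hstd : IsStandardGraded 𝒜) {I : Ideal R} (hI : I.IsHomogeneous 𝒜)
    (h : ringKrullDim (R ⧸ I) < ringKrullDim R) : multQuot 𝒜 I = 0 := by
  obtain ⟨d, hd⟩ := hstd.ringKrullDim_eq
  obtain ⟨L, hL, h0, -⟩ := exists_tendsto_cumHilbert hstd hI (hd ▸ ringKrullDim_quotient_le I)
  rw [multQuot_eq_of_tendsto hd hL, h0 (hd ▸ h)]

theorem multQuot_pos (hstd : IsStandardGraded 𝒜) {I : Ideal R} (hI : I.IsHomogeneous 𝒜)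
    (h : ringKrullDim (R ⧸ I) = ringKrullDim R) : 0 < multQuot 𝒜 I := by
  obtain ⟨d, hd⟩ := hstd.ringKrullDim_eq
  obtain ⟨L, hL, -, h0⟩ := exists_tendsto_cumHilbert hstd hI (hd ▸ ringKrullDim_quotient_le I)
  rw [multQuot_eq_of_tendsto hd hL]
  exact h0 (h.trans hd)

theorem cumHilbert_inf_add_sup (hstd : IsStandardGraded 𝒜) {I J : Ideal R} (hI : I.IsHomogeneous 𝒜)
    (hJ : J.IsHomogeneous 𝒜) (t : ℕ) :
    cumHilbert 𝒜 (I ⊓ J) t + cumHilbert 𝒜 (I ⊔ J) t = cumHilbert 𝒜 I t + cumHilbert 𝒜 J t := by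
  simp only [cumHilbert, ← Finset.sum_add_distrib]
  refine Finset.sum_congr rfl fun i _ => ?_
  exact_mod_cast hilbertFunction_inf_add_sup hstd hI hJ i

/-- The sequence `0 → R/(I ∩ J) → R/I ⊕ R/J → R/(I + J) → 0` makes the multiplicity additive when
its last term has small dimension. -/
theorem multQuot_inf (hstd : IsStandardGraded 𝒜) {I J : Ideal R} (hI : I.IsHomogeneous 𝒜)
    (hJ : J.IsHomogeneous 𝒜) (h : ringKrullDim (R ⧸ (I ⊔ J)) < ringKrullDim R) :
    multQuot 𝒜 (I ⊓ J) = multQuot 𝒜 I + multQuot 𝒜 J := by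
  obtain ⟨d, hd⟩ := hstd.ringKrullDim_eq
  have h0 := multQuot_eq_zero hstd (hI.sup hJ) h
  have h1 := tendsto_multQuot hstd (hI.sup hJ) hd
  rw [h0] at h1
  have h2 := ((tendsto_multQuot hstd hI hd).add (tendsto_multQuot hstd hJ hd)).sub h1
  rw [sub_zero] at h2
  refine multQuot_eq_of_tendsto hd (h2.congr fun t => ?_)
  rw [eq_sub_of_add_eq (cumHilbert_inf_add_sup hstd hI hJ t)]
  ring

omit [GradedAlgebra 𝒜] in
theorem cumHilbert_bot (t : ℕ) :
    cumHilbert 𝒜 (⊥ : Ideal R) t =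
      ∑ i ∈ Finset.range (t + 1), (hilbertFunction 𝒜 i : ℝ) := by
  refine Finset.sum_congr rfl fun i _ => ?_
  have hinj : Function.Injective (Ideal.Quotient.mkₐ K (⊥ : Ideal R)).toLinearMap := by
    rw [← LinearMap.ker_eq_bot, ker_mkₐ_toLinearMap, Submodule.restrictScalars_bot]
  rw [hilbertFunction, hilbertFunction, quotientGrading,
    (Submodule.equivMapOfInjective _ hinj (𝒜 i)).finrank_eq]

omit [GradedAlgebra 𝒜] in
theorem hsMultiplicity_eq_multQuot_bot : hsMultiplicity R 𝒜 = multQuot 𝒜 (⊥ : Ideal R) := by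
  unfold multQuot hsMultiplicity
  congr 1
  funext t
  rw [← cumHilbert_bot]
  rfl

/-- In dimension at most one the Hilbert function is eventually constant, equal to the
multiplicity. -/
theorem eventually_hilbertFunction_eq (hstd : IsStandardGraded 𝒜) {I : Ideal R}
    (hI : I.IsHomogeneous 𝒜) {L : ℝ} (hd : ringKrullDim (R ⧸ I) ≤ 1)
    (h : Tendsto (fun t : ℕ => ((Nat.factorial 1 : ℕ) : ℝ) * cumHilbert 𝒜 I t / (t : ℝ) ^ 1) atTop
      (𝓝 L)) :
    ∀ᶠ t : ℕ in atTop, (hilbertFunction (quotientGrading 𝒜 I) t : ℝ) = L := by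
  obtain ⟨p, hp, hpd⟩ : ∃ p : Polynomial ℝ,
      (∀ᶠ t : ℕ in atTop, cumHilbert 𝒜 I t = p.eval (t : ℝ)) ∧ p.natDegree ≤ 1 := by
    by_cases htop : I = ⊤
    · exact ⟨0, by simp [htop, cumHilbert_top], by simp⟩
    · obtain ⟨D, hD, p, hp, hpD, -⟩ := exists_cumHilbertPolynomial_natDegree_eq hstd hI htop
      refine ⟨p, hp, ?_⟩
      rw [hD] at hd
      rw [hpD]
      exact_mod_cast hd
  obtain ⟨a, b, rfl⟩ := Polynomial.exists_eq_X_add_C_of_natDegree_le_one hpd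
  have ha : Tendsto (fun t : ℕ => a + b / (t : ℝ)) atTop (𝓝 (a + 0)) :=
    tendsto_const_nhds.add (tendsto_const_div_atTop_nhds_zero_nat b)
  have hL : L = a := by
    rw [add_zero] at ha
    refine tendsto_nhds_unique h (ha.congr' ?_)
    filter_upwards [hp, eventually_gt_atTop 0] with t ht ht0
    rw [ht]
    have : (t : ℝ) ≠ 0 := by positivity
    simp
    field_simp
  filter_upwards [hp, (tendsto_sub_atTop_nat 1).eventually hp, eventually_ge_atTop 1]
    with t ht ht' ht1
  obtain ⟨t, rfl⟩ := Nat.exists_eq_add_of_le' ht1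
  rw [Nat.add_sub_cancel] at ht'
  rw [cumHilbert_succ, ht'] at ht
  simp at ht
  linarith

theorem eventually_hilbertFunction_eq_zero (hstd : IsStandardGraded 𝒜) {I : Ideal R}
    (hI : I.IsHomogeneous 𝒜) (hd : ringKrullDim (R ⧸ I) < 1) :
    ∀ᶠ t : ℕ in atTop, hilbertFunction (quotientGrading 𝒜 I) t = 0 := by
  obtain ⟨L, hL, h0, -⟩ := exists_tendsto_cumHilbert hstd hI (d := 1) (by exact_mod_cast hd.le)
  rw [h0 (by exact_mod_cast hd)] at hL
  exact_mod_cast eventually_hilbertFunction_eq hstd hI hd.le hL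

/-- If `I ≤ J`, `dim R/I ≥ 2` and `dim R/J < dim R/I`, the Hilbert function of `R/I` eventually
exceeds that of `R/J` by any given amount: otherwise the difference, being eventually polynomial,
would be eventually constant, and its sums would grow at most linearly. -/
theorem eventually_add_le_hilbertFunction (hstd : IsStandardGraded 𝒜) {I J : Ideal R}
    (hI : I.IsHomogeneous 𝒜) (hJ : J.IsHomogeneous 𝒜) (hIJ : I ≤ J)
    (h2 : 2 ≤ ringKrullDim (R ⧸ I)) (hlt : ringKrullDim (R ⧸ J) < ringKrullDim (R ⧸ I)) (ℓ : ℕ) :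
    ∀ᶠ t : ℕ in atTop, hilbertFunction (quotientGrading 𝒜 J) t + ℓ ≤
      hilbertFunction (quotientGrading 𝒜 I) t := by
  have htop : I ≠ ⊤ := by
    rintro rfl
    have : Subsingleton (R ⧸ (⊤ : Ideal R)) := Ideal.Quotient.subsingleton_iff.2 rfl
    rw [ringKrullDim_eq_bot_of_subsingleton] at h2
    exact absurd h2 (by simp)
  obtain ⟨D, hD⟩ := hstd.exists_ringKrullDim_eq hI htop
  rw [hD] at h2 hlt
  have hD2 : 2 ≤ D := by exact_mod_cast h2
  obtain ⟨L, hL, -, hLpos⟩ := exists_tendsto_cumHilbert hstd hI hD.le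
  obtain ⟨L', hL', hL0, -⟩ := exists_tendsto_cumHilbert hstd hJ hlt.le
  have hlim := hL.sub hL'
  rw [hL0 hlt, sub_zero] at hlim
  obtain ⟨p, hp⟩ := exists_hilbertPolynomial hstd hI
  obtain ⟨p', hp'⟩ := exists_hilbertPolynomial hstd hJ
  have hcast := tendsto_natCast_atTop_atTop (R := ℝ)
  have hnonneg : ∀ᶠ t : ℕ in atTop, 0 ≤ (p - p').eval (t : ℝ) := by
    filter_upwards [hp, hp'] with t ht ht'
    rw [Polynomial.eval_sub, ← ht, ← ht', sub_nonneg]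
    have h1 := hilbertFunction_add_finrank_idealPiece hstd I t
    have h3 := hilbertFunction_add_finrank_idealPiece hstd J t
    have := hstd.finite t
    have hfJ : Module.Finite K (idealPiece 𝒜 J t) := Submodule.finiteDimensional_inf_left _ _
    have h4 : Module.finrank K (idealPiece 𝒜 I t) ≤ Module.finrank K (idealPiece 𝒜 J t) :=
      Submodule.finrank_mono fun x hx => ⟨hx.1, hIJ hx.2⟩
    exact_mod_cast (by omega : hilbertFunction (quotientGrading 𝒜 J) t ≤
      hilbertFunction (quotientGrading 𝒜 I) t)
  have hdeg : 0 < (p - p').degree := by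
    by_contra hdeg
    obtain ⟨k, hk⟩ : ∃ k, p - p' = Polynomial.C k :=
      ⟨_, Polynomial.eq_C_of_degree_le_zero (not_lt.1 hdeg)⟩
    have hev : ∀ᶠ t : ℕ in atTop, (cumHilbert 𝒜 I (t + 1) - cumHilbert 𝒜 J (t + 1)) -
        (cumHilbert 𝒜 I t - cumHilbert 𝒜 J t) = k := by
      filter_upwards [(tendsto_add_atTop_nat 1).eventually hp,
        (tendsto_add_atTop_nat 1).eventually hp'] with t ht ht'
      have := congrArg (Polynomial.eval ((t + 1 : ℕ) : ℝ)) hk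
      rw [Polynomial.eval_sub, Polynomial.eval_C, ← ht, ← ht'] at this
      rw [cumHilbert_succ, cumHilbert_succ, ← this]
      ring
    obtain ⟨N, hN⟩ := eventually_atTop.1 hev
    have hlin : ∀ᶠ t : ℕ in atTop, cumHilbert 𝒜 I t - cumHilbert 𝒜 J t =
        (Polynomial.C k * Polynomial.X + Polynomial.C (cumHilbert 𝒜 I N - cumHilbert 𝒜 J N -
          k * N) : Polynomial ℝ).eval (t : ℝ) := by
      refine eventually_atTop.2 ⟨N, fun t ht => ?_⟩
      simp only [Polynomial.eval_add, Polynomial.eval_mul, Polynomial.eval_C, Polynomial.eval_X]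
      induction t, ht using Nat.le_induction with
      | base => ring
      | succ t ht ih =>
        have h1 := hN t ht
        push_cast
        linarith
    have hz := ((Polynomial.div_tendsto_atTop_zero_of_degree_lt
      (Polynomial.C k * Polynomial.X + Polynomial.C (cumHilbert 𝒜 I N - cumHilbert 𝒜 J N -
          k * N) : Polynomial ℝ) (Polynomial.X ^ D) (by
        refine Polynomial.degree_linear_le.trans_lt ?_
        rw [Polynomial.degree_X_pow]
        exact_mod_cast hD2)).comp hcast).const_mul (D.factorial : ℝ)
    rw [mul_zero] at hz
    have : L = 0 := by
      refine tendsto_nhds_unique hlim (hz.congr' ?_)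
      filter_upwards [hlin] with t ht
      rw [Function.comp_apply, ← ht, Polynomial.eval_pow, Polynomial.eval_X]
      ring
    exact (hLpos hD).ne' this
  have hlead : 0 ≤ (p - p').leadingCoeff := by
    by_contra hneg
    have := ((p - p').tendsto_atBot_of_leadingCoeff_nonpos hdeg (not_le.1 hneg).le).comp hcast
    obtain ⟨t, ht, ht'⟩ := ((this.eventually_lt_atBot 0).and hnonneg).exists
    exact absurd ht (not_lt.2 ht')
  have hinf := ((p - p').tendsto_atTop_of_leadingCoeff_nonneg hdeg hlead).comp hcast
  filter_upwards [hinf.eventually_ge_atTop (ℓ : ℝ), hp, hp'] with t ht h1 h1'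
  rw [Function.comp_apply, Polynomial.eval_sub, ← h1, ← h1'] at ht
  have : (hilbertFunction (quotientGrading 𝒜 J) t : ℝ) + ℓ ≤
    hilbertFunction (quotientGrading 𝒜 I) t := by linarith
  exact_mod_cast this

end GMD

/-! ### Minimal primes of reduced rings -/

section MinimalPrimes

variable {R : Type*} [CommRing R] {ι : Type*} {P : ι → Ideal R}

theorem isPrime_of_range_eq_minimalPrimes (hmin : Set.range P = minimalPrimes R) (i : ι) :
    (P i).IsPrime :=
  (show P i ∈ minimalPrimes R from hmin ▸ Set.mem_range_self i).1.1

theorem exists_le_of_range_eq_minimalPrimes (hmin : Set.range P = minimalPrimes R) {Q : Ideal R}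
    (hQ : Q.IsPrime) : ∃ i, P i ≤ Q := by
  obtain ⟨p, hp, hpQ⟩ := Ideal.exists_minimalPrimes_le (I := (⊥ : Ideal R)) (J := Q) bot_le
  obtain ⟨i, rfl⟩ : p ∈ Set.range P := hmin ▸ hp
  exact ⟨i, hpQ⟩

theorem eq_of_le_of_range_eq_minimalPrimes (hmin : Set.range P = minimalPrimes R)
    (hinj : Function.Injective P) {i j : ι} (h : P i ≤ P j) : i = j := by
  have hi := isPrime_of_range_eq_minimalPrimes hmin i
  have hj : P j ∈ minimalPrimes R := hmin ▸ Set.mem_range_self j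
  exact hinj (le_antisymm h (hj.2 ⟨hi, bot_le⟩ h))

theorem eq_zero_of_forall_mem_minimalPrimes [IsReduced R] (hmin : Set.range P = minimalPrimes R)
    {x : R} (hx : ∀ i, x ∈ P i) : x = 0 := by
  have : x ∈ sInf (minimalPrimes R) := by
    rw [← hmin, Submodule.mem_sInf]
    rintro _ ⟨i, rfl⟩
    exact hx i
  rw [minimalPrimes, Ideal.sInf_minimalPrimes] at this
  exact (mem_nilradical.1 this).eq_zero

theorem exists_mem_le_of_inf_le (hmin : Set.range P = minimalPrimes R)
    (hinj : Function.Injective P) {S : Finset ι} {k : ι} (h : S.inf P ≤ P k) : k ∈ S := by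
  obtain ⟨i, hi, hik⟩ := (isPrime_of_range_eq_minimalPrimes hmin k).inf_le'.1 h
  exact eq_of_le_of_range_eq_minimalPrimes hmin hinj hik ▸ hi

/-- In a reduced ring the associated primes are the minimal primes. -/
theorem associatedPrimes_eq_minimalPrimes [IsReduced R] [IsNoetherianRing R] :
    associatedPrimes R R = minimalPrimes R := by
  apply Set.Subset.antisymm
  · rintro Q ⟨hQ, x, hx⟩
    have hx0 : x ≠ 0 := by
      rintro rfl
      refine hQ.ne_top ?_
      rw [hx, Ideal.radical_eq_top, Ideal.eq_top_iff_one, Submodule.mem_colon_singleton]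
      simp
    have hid : Set.range ((↑) : minimalPrimes R → Ideal R) = minimalPrimes R := Subtype.range_coe
    obtain ⟨⟨M, hM⟩, hxM⟩ : ∃ M : minimalPrimes R, x ∉ M.1 := by
      by_contra! hcon
      exact hx0 (eq_zero_of_forall_mem_minimalPrimes hid hcon)
    have hQM : Q ≤ M := fun y hy => by
      rw [hx] at hy
      obtain ⟨n, hn⟩ := hy
      rw [Submodule.mem_colon_singleton, Submodule.mem_bot, smul_eq_mul] at hn
      refine hM.1.1.mem_of_pow_mem n ((hM.1.1.mem_or_mem ?_).resolve_right hxM)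
      rw [hn]
      exact zero_mem _
    rwa [le_antisymm hQM (hM.2 ⟨hQ, bot_le⟩ hQM)]
  · have := Module.associatedPrimes.minimalPrimes_annihilator_subset_associatedPrimes R R
    rwa [(Module.annihilator_eq_bot (R := R) (M := R)).2 inferInstance] at this

theorem annihilator_ne_bot_iff [IsReduced R] [Finite ι] (hmin : Set.range P = minimalPrimes R)
    (hinj : Function.Injective P) {I : Ideal R} :
    I.annihilator ≠ ⊥ ↔ ∃ i, I ≤ P i := by
  classical
  have := Fintype.ofFinite ι
  constructor
  · intro h
    obtain ⟨r, hr, hr0⟩ := Submodule.exists_mem_ne_zero_of_ne_bot h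
    obtain ⟨i, hi⟩ : ∃ i, r ∉ P i := by
      by_contra! hcon
      exact hr0 (eq_zero_of_forall_mem_minimalPrimes hmin hcon)
    refine ⟨i, fun x hx => ?_⟩
    have h0 : r * x = 0 := Submodule.mem_annihilator.1 hr x hx
    exact ((isPrime_of_range_eq_minimalPrimes hmin i).mem_or_mem
      (h0 ▸ (P i).zero_mem : r * x ∈ P i)).resolve_left hi
  · rintro ⟨i, hi⟩ h
    have hle : (Finset.univ.erase i).inf P ≤ I.annihilator := fun y hy => by
      rw [Submodule.mem_annihilator]
      intro x hx
      refine eq_zero_of_forall_mem_minimalPrimes hmin fun k => ?_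
      by_cases hk : k = i
      · exact (P k).mul_mem_left _ (hk ▸ hi hx)
      · exact (P k).mul_mem_right _
          ((Finset.inf_le (f := P) (Finset.mem_erase.2 ⟨hk, Finset.mem_univ k⟩)) hy)
    rw [h] at hle
    exact Finset.notMem_erase i _
      (exists_mem_le_of_inf_le hmin hinj (hle.trans (bot_le (a := P i))))

end MinimalPrimes

namespace GMD

variable {K : Type*} [Field K] {R : Type*} [CommRing R] [Algebra K R]
  {𝒜 : ℕ → Submodule K R} [GradedAlgebra 𝒜]

theorem isHomogeneous_of_mem_minimalPrimes {Q : Ideal R} (hQ : Q ∈ minimalPrimes R) :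
    Q.IsHomogeneous 𝒜 := by
  have hle := Ideal.toIdeal_homogeneousCore_le 𝒜 Q
  rw [Ideal.IsHomogeneous.iff_eq]
  exact le_antisymm hle (hQ.2 ⟨hQ.1.1.homogeneousCore, bot_le⟩ hle)

theorem isHomogeneous_inf {ι : Type*} {P : ι → Ideal R} (h : ∀ i, (P i).IsHomogeneous 𝒜)
    (S : Finset ι) : (S.inf P).IsHomogeneous 𝒜 := by
  rw [Finset.inf_eq_iInf]
  exact Ideal.IsHomogeneous.iInf fun i => Ideal.IsHomogeneous.iInf fun _ => h i

theorem ringKrullDim_quotient_lt_of_forall_not_le (hstd : IsStandardGraded 𝒜) {ι : Type*}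
    {P : ι → Ideal R} (hmin : Set.range P = minimalPrimes R) {I : Ideal R}
    (hI : ∀ i, ¬ I ≤ P i) : ringKrullDim (R ⧸ I) < ringKrullDim R := by
  obtain ⟨d, hd⟩ := hstd.ringKrullDim_eq
  rw [hd]
  refine ringKrullDim_quotient_lt_of_forall_prime fun Q hQ hIQ => ?_
  obtain ⟨i, hi⟩ := exists_le_of_range_eq_minimalPrimes hmin hQ
  have := isPrime_of_range_eq_minimalPrimes hmin i
  exact ringKrullDim_quotient_lt_of_lt (lt_of_le_of_ne hi fun h => hI i (h ▸ hIQ))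
    (hd ▸ ringKrullDim_quotient_le _)

theorem multQuot_top (hstd : IsStandardGraded 𝒜) : multQuot 𝒜 (⊤ : Ideal R) = 0 := by
  obtain ⟨d, hd⟩ := hstd.ringKrullDim_eq
  exact multQuot_eq_of_tendsto hd (by simp [cumHilbert_top])

/-- Additivity of the multiplicity over an intersection of minimal primes. -/
theorem multQuot_inf_minimalPrimes (hstd : IsStandardGraded 𝒜) {ι : Type*}
    {P : ι → Ideal R} (hmin : Set.range P = minimalPrimes R) (hinj : Function.Injective P)
    (S : Finset ι) : multQuot 𝒜 (S.inf P) = ∑ i ∈ S, multQuot 𝒜 (P i) := by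
  have hhom : ∀ i, (P i).IsHomogeneous 𝒜 := fun i =>
    isHomogeneous_of_mem_minimalPrimes (hmin ▸ Set.mem_range_self i)
  induction S using Finset.cons_induction with
  | empty => simpa using multQuot_top hstd
  | cons i S hi ih =>
    rw [Finset.inf_cons, Finset.sum_cons, ← ih]
    -- a minimal prime containing both `P i` and the intersection would be `P i` and lie in `S`
    refine multQuot_inf hstd (hhom i) (isHomogeneous_inf hhom S)
      (ringKrullDim_quotient_lt_of_forall_not_le hstd hmin fun k hk => hi ?_)
    rw [eq_of_le_of_range_eq_minimalPrimes hmin hinj (le_sup_left.trans hk)]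
    exact exists_mem_le_of_inf_le hmin hinj (le_sup_right.trans hk)

open Classical in
/-- The drop `e(R) - e(R/I)` is the sum of `e(R/P)` over the minimal primes `P` not containing `I`.
Indeed, if `J` is the intersection of these primes then `I ∩ J = 0` while `I + J` lies in no
minimal prime. -/
theorem multQuot_add_sum_not_le (hstd : IsStandardGraded 𝒜) [IsReduced R] {ι : Type*} [Fintype ι]
    {P : ι → Ideal R} (hmin : Set.range P = minimalPrimes R) (hinj : Function.Injective P)
    {I : Ideal R} (hI : I.IsHomogeneous 𝒜) :
    multQuot 𝒜 I + ∑ i with ¬ I ≤ P i, multQuot 𝒜 (P i) = hsMultiplicity R 𝒜 := by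
  have hhom : ∀ i, (P i).IsHomogeneous 𝒜 := fun i =>
    isHomogeneous_of_mem_minimalPrimes (hmin ▸ Set.mem_range_self i)
  set W : Finset ι := {i | ¬ I ≤ P i}
  have hinf : I ⊓ W.inf P = ⊥ := by
    rw [eq_bot_iff]
    rintro x ⟨hxI, hxW⟩
    refine eq_zero_of_forall_mem_minimalPrimes hmin fun i => ?_
    by_cases hi : I ≤ P i
    · exact hi hxI
    · exact (Finset.inf_le (f := P) (show i ∈ W by simp [W, hi])) hxW
  rw [← multQuot_inf_minimalPrimes hstd hmin hinj, hsMultiplicity_eq_multQuot_bot, ← hinf]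
  refine (multQuot_inf hstd hI (isHomogeneous_inf hhom W)
    (ringKrullDim_quotient_lt_of_forall_not_le hstd hmin fun k hk => ?_)).symm
  have := exists_mem_le_of_inf_le hmin hinj (le_sup_right.trans hk)
  simp only [W, Finset.mem_filter] at this
  exact this.2 (le_sup_left.trans hk)

/-- A homogeneous prime of dimension zero contains every proper homogeneous ideal. -/
theorem le_of_ringKrullDim_quotient_lt_one (hstd : IsStandardGraded 𝒜) {I Q : Ideal R}
    (hI : I.IsHomogeneous 𝒜) (hI' : I ≠ ⊤) (hQ : Q.IsHomogeneous 𝒜) [hQp : Q.IsPrime]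
    (h : ringKrullDim (R ⧸ Q) < 1) : I ≤ Q := by
  classical
  obtain ⟨N, hN⟩ := eventually_atTop.1 (eventually_hilbertFunction_eq_zero hstd hQ h)
  intro x hx
  rw [← DirectSum.sum_support_decompose 𝒜 x]
  refine sum_mem fun i _ => ?_
  have hxi := hI i hx
  have hmem : (DirectSum.decompose 𝒜 x i : R) ∈ 𝒜 i := Subtype.prop _
  generalize (DirectSum.decompose 𝒜 x i : R) = y at hxi hmem
  rcases Nat.eq_zero_or_pos i with rfl | hi
  · rw [hstd.zero_eq_one] at hmem
    obtain ⟨c, rfl⟩ := Submodule.mem_one.1 hmem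
    by_cases hc : c = 0
    · simp [hc]
    · exact absurd (Ideal.eq_top_of_isUnit_mem I hxi ((IsUnit.mk0 c hc).map (algebraMap K R))) hI'
  · refine hQp.mem_of_pow_mem (N) ?_
    have h0 := hN (N * i) (Nat.le_mul_of_pos_right N hi)
    have hfin := hstd.finite (N * i)
    have : Module.Finite K (quotientGrading 𝒜 Q (N * i)) := Module.Finite.map _ _
    have hbot : quotientGrading 𝒜 Q (N * i) = ⊥ := Submodule.finrank_eq_zero.1 h0
    have hyN : y ^ N ∈ 𝒜 (N * i) := by
      rw [← smul_eq_mul]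
      exact SetLike.pow_mem_graded N hmem
    have : Ideal.Quotient.mk Q (y ^ N) ∈ quotientGrading 𝒜 Q (N * i) := ⟨_, hyN, rfl⟩
    rw [hbot, Submodule.mem_bot, Ideal.Quotient.eq_zero_iff_mem] at this
    exact this

/-! ### Forms in an intersection of minimal primes -/

/-- If `I ∩ J = 0` then `I` embeds into `R/J`, with cokernel `R/(I + J)`. -/
theorem finrank_idealPiece_add (hstd : IsStandardGraded 𝒜) {I J : Ideal R}
    (hI : I.IsHomogeneous 𝒜) (hJ : J.IsHomogeneous 𝒜) (hIJ : I ⊓ J = ⊥) (t : ℕ) :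
    Module.finrank K (idealPiece 𝒜 I t) + hilbertFunction (quotientGrading 𝒜 (I ⊔ J)) t =
      hilbertFunction (quotientGrading 𝒜 J) t := by
  have h1 := hilbertFunction_inf_add_sup hstd hI hJ t
  have h2 := hilbertFunction_add_finrank_idealPiece hstd I t
  have h3 := hilbertFunction_add_finrank_idealPiece hstd (⊥ : Ideal R) t
  have h4 : idealPiece 𝒜 (⊥ : Ideal R) t = ⊥ := by
    rw [idealPiece, Submodule.restrictScalars_bot, inf_bot_eq]
  rw [h4, finrank_bot] at h3
  rw [hIJ] at h1
  omega

theorem eventually_finrank_idealPiece_eq (hstd : IsStandardGraded 𝒜) {I J : Ideal R}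
    (hI : I.IsHomogeneous 𝒜) (hJ : J.IsHomogeneous 𝒜) (hIJ : I ⊓ J = ⊥)
    (hdim : ringKrullDim (R ⧸ (I ⊔ J)) < 1) {L : ℝ} (hd : ringKrullDim (R ⧸ J) ≤ 1)
    (h : Tendsto (fun t : ℕ => ((Nat.factorial 1 : ℕ) : ℝ) * cumHilbert 𝒜 J t / (t : ℝ) ^ 1) atTop
      (𝓝 L)) :
    ∀ᶠ t : ℕ in atTop, (Module.finrank K (idealPiece 𝒜 I t) : ℝ) = L := by
  filter_upwards [eventually_hilbertFunction_eq hstd hJ hd h,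
    eventually_hilbertFunction_eq_zero hstd (hI.sup hJ) hdim] with t h1 h2
  rw [← h1, ← finrank_idealPiece_add hstd hI hJ hIJ t, h2, add_zero]

theorem inf_compl_inf_eq_bot [IsReduced R] {ι : Type*} [Fintype ι] [DecidableEq ι]
    {P : ι → Ideal R} (hmin : Set.range P = minimalPrimes R) (S : Finset ι) :
    S.inf P ⊓ Sᶜ.inf P = ⊥ := by
  rw [eq_bot_iff]
  rintro x ⟨hx, hx'⟩
  refine eq_zero_of_forall_mem_minimalPrimes hmin fun i => ?_
  by_cases hi : i ∈ S
  · exact (Finset.inf_le (f := P) hi) hx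
  · exact (Finset.inf_le (f := P) (Finset.mem_compl.2 hi)) hx'

theorem not_inf_sup_compl_inf_le {ι : Type*} [Fintype ι] [DecidableEq ι]
    {P : ι → Ideal R} (hmin : Set.range P = minimalPrimes R) (hinj : Function.Injective P)
    (S : Finset ι) (k : ι) : ¬ S.inf P ⊔ Sᶜ.inf P ≤ P k := fun hk =>
  Finset.mem_compl.1 (exists_mem_le_of_inf_le hmin hinj (le_sup_right.trans hk))
    (exists_mem_le_of_inf_le hmin hinj (le_sup_left.trans hk))

theorem eventually_finrank_idealPiece_eq_sum (hstd : IsStandardGraded 𝒜) [IsReduced R] {ι : Type*}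
    [Fintype ι] [DecidableEq ι] {P : ι → Ideal R} (hmin : Set.range P = minimalPrimes R)
    (hinj : Function.Injective P) (hd : ringKrullDim R = 1) (S : Finset ι) :
    ∀ᶠ t : ℕ in atTop, (Module.finrank K (idealPiece 𝒜 (S.inf P) t) : ℝ) =
      ∑ i ∈ Sᶜ, multQuot 𝒜 (P i) := by
  have hhom : ∀ i, (P i).IsHomogeneous 𝒜 := fun i =>
    isHomogeneous_of_mem_minimalPrimes (hmin ▸ Set.mem_range_self i)
  rw [← multQuot_inf_minimalPrimes hstd hmin hinj]
  refine eventually_finrank_idealPiece_eq hstd (isHomogeneous_inf hhom S)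
    (isHomogeneous_inf hhom Sᶜ) (inf_compl_inf_eq_bot hmin S) ?_
    (hd ▸ ringKrullDim_quotient_le _) (tendsto_multQuot hstd (isHomogeneous_inf hhom Sᶜ) hd)
  rw [← hd]
  exact ringKrullDim_quotient_lt_of_forall_not_le hstd hmin
    (not_inf_sup_compl_inf_le hmin hinj S)

/-- If `dim R/P ≥ 2`, the number of independent forms vanishing on all components except that of
`P` is unbounded. -/
theorem eventually_le_finrank_idealPiece (hstd : IsStandardGraded 𝒜) [IsReduced R] {ι : Type*}
    [Fintype ι] [DecidableEq ι] {P : ι → Ideal R} (hmin : Set.range P = minimalPrimes R)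
    (hinj : Function.Injective P) {i : ι} (hi : 2 ≤ ringKrullDim (R ⧸ P i)) (ℓ : ℕ) :
    ∀ᶠ t : ℕ in atTop, ℓ ≤ Module.finrank K (idealPiece 𝒜 (({i} : Finset ι)ᶜ.inf P) t) := by
  have hhom : ∀ i, (P i).IsHomogeneous 𝒜 := fun i =>
    isHomogeneous_of_mem_minimalPrimes (hmin ▸ Set.mem_range_self i)
  have hprime := isPrime_of_range_eq_minimalPrimes hmin
  have hinf := inf_compl_inf_eq_bot hmin ({i}ᶜ : Finset ι)
  have hsup := not_inf_sup_compl_inf_le hmin hinj ({i}ᶜ : Finset ι)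
  rw [compl_compl, Finset.inf_singleton] at hinf hsup
  obtain ⟨D, hD⟩ := hstd.exists_ringKrullDim_eq (hhom i) (hprime i).ne_top
  have hlt : ringKrullDim (R ⧸ (({i} : Finset ι)ᶜ.inf P ⊔ P i)) < ringKrullDim (R ⧸ P i) := by
    rw [hD]
    refine ringKrullDim_quotient_lt_of_forall_prime fun Q hQ hle => ?_
    have := hprime i
    exact ringKrullDim_quotient_lt_of_lt
      (lt_of_le_of_ne (le_sup_right.trans hle) fun h => hsup i (h ▸ hle)) hD.le
  have hJ := isHomogeneous_inf hhom ({i}ᶜ : Finset ι)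
  filter_upwards [eventually_add_le_hilbertFunction hstd (hhom i) (hJ.sup (hhom i)) le_sup_right
    hi hlt ℓ] with t ht
  have := finrank_idealPiece_add hstd hJ (hhom i) hinf t
  omega

/-! ### The generalized minimum distance function through minimal primes -/

theorem isHomogeneous_span_range {t ℓ : ℕ} {f : Fin ℓ → R} (hf : ∀ i, f i ∈ 𝒜 t) :
    (Ideal.span (Set.range f)).IsHomogeneous 𝒜 :=
  Ideal.homogeneous_span _ _ (by rintro _ ⟨i, rfl⟩; exact ⟨t, hf i⟩)

omit [GradedAlgebra 𝒜] in
theorem mem_formFamilies_iff [IsReduced R] {ι : Type*} [Finite ι] {P : ι → Ideal R}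
    (hmin : Set.range P = minimalPrimes R) (hinj : Function.Injective P) {t ℓ : ℕ}
    {f : Fin ℓ → R} : f ∈ formFamilies 𝒜 t ℓ ↔ (∀ i, f i ∈ 𝒜 t) ∧ LinearIndependent K f ∧
      ∃ i, Ideal.span (Set.range f) ≤ P i := by
  rw [formFamilies, Set.mem_ofPred_eq, annihilator_ne_bot_iff hmin hinj]

omit [GradedAlgebra 𝒜] in
theorem exists_mem_formFamilies [IsReduced R] {ι : Type*} [Finite ι] {P : ι → Ideal R}
    (hmin : Set.range P = minimalPrimes R) (hinj : Function.Injective P) {t ℓ : ℕ}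
    {S : Finset ι} (hS : S.Nonempty) (hℓ : ℓ ≤ Module.finrank K (idealPiece 𝒜 (S.inf P) t)) :
    ∃ f ∈ formFamilies 𝒜 t ℓ, ∀ i ∈ S, Ideal.span (Set.range f) ≤ P i := by
  obtain ⟨g, hg⟩ := exists_linearIndependent_of_le_finrank hℓ
  have hle : ∀ i ∈ S, Ideal.span (Set.range fun k => (g k : R)) ≤ P i := fun i hi => by
    rw [Ideal.span_le]
    rintro _ ⟨k, rfl⟩
    exact (Finset.inf_le (f := P) hi) (g k).2.2
  obtain ⟨i, hi⟩ := hS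
  exact ⟨fun k => g k, (mem_formFamilies_iff hmin hinj).2 ⟨fun k => (g k).2.1,
    hg.map' (Submodule.subtype _) (Submodule.ker_subtype _), i, hle i hi⟩, hle⟩

omit [GradedAlgebra 𝒜] in
theorem le_finrank_idealPiece (hfin : ∀ t, Module.Finite K (𝒜 t)) {t ℓ : ℕ} {f : Fin ℓ → R}
    {I : Ideal R} (hf : ∀ i, f i ∈ 𝒜 t) (hli : LinearIndependent K f)
    (hI : Ideal.span (Set.range f) ≤ I) : ℓ ≤ Module.finrank K (idealPiece 𝒜 I t) := by
  have := hfin t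
  have hfI : Module.Finite K (idealPiece 𝒜 I t) := Submodule.finiteDimensional_inf_left _ _
  have hg : LinearIndependent K fun i =>
      (⟨f i, hf i, hI (Ideal.subset_span (Set.mem_range_self i))⟩ : idealPiece 𝒜 I t) :=
    LinearIndependent.of_comp (Submodule.subtype _) hli
  simpa using hg.fintype_card_le_finrank

omit [GradedAlgebra 𝒜] in
theorem not_span_range_le_bot {ℓ : ℕ} (hℓ : 1 ≤ ℓ) {f : Fin ℓ → R}
    (hli : LinearIndependent K f) : ¬ Ideal.span (Set.range f) ≤ ⊥ := fun h =>
  hli.ne_zero ⟨0, hℓ⟩ (h (Ideal.subset_span (Set.mem_range_self _)))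

omit [GradedAlgebra 𝒜] in
theorem gmd_eq_of_forall_not_mem {t ℓ : ℕ} (h : ∀ f, f ∉ formFamilies 𝒜 t ℓ) :
    gmd 𝒜 t ℓ = hsMultiplicity R 𝒜 := by
  rw [gmd, if_neg]
  rintro ⟨f, hf⟩
  exact h f hf

omit [GradedAlgebra 𝒜] in
/-- `δ(t, ℓ)` is the least drop `c f = e(R) - e(R/(f))` over the admissible families. -/
theorem gmd_eq_of_forall_le {t ℓ : ℕ} {v : ℝ} {c : (Fin ℓ → R) → ℝ}
    (hc : ∀ f ∈ formFamilies 𝒜 t ℓ,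
      multQuot 𝒜 (Ideal.span (Set.range f)) + c f = hsMultiplicity R 𝒜)
    {f₀ : Fin ℓ → R} (hf₀ : f₀ ∈ formFamilies 𝒜 t ℓ) (hle₀ : c f₀ ≤ v)
    (hle : ∀ f ∈ formFamilies 𝒜 t ℓ, v ≤ c f) : gmd 𝒜 t ℓ = v := by
  rw [gmd, if_pos ⟨f₀, hf₀⟩]
  have : IsGreatest ((fun f : Fin ℓ → R => multQuot 𝒜 (Ideal.span (Set.range f))) ''
      formFamilies 𝒜 t ℓ) (hsMultiplicity R 𝒜 - v) := by
    refine ⟨⟨f₀, hf₀, ?_⟩, ?_⟩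
    · have h1 := hc f₀ hf₀
      have h2 := hle f₀ hf₀
      dsimp only
      linarith
    · rintro _ ⟨f, hf, rfl⟩
      have h1 := hc f hf
      have h2 := hle f hf
      dsimp only
      linarith
  rw [this.csSup_eq, sub_sub_cancel]

omit [GradedAlgebra 𝒜] in
theorem stabilizationValue_eq {ℓ : ℕ} {v : ℝ} (h : ∀ᶠ t in atTop, gmd 𝒜 t ℓ = v) :
    stabilizationValue 𝒜 ℓ = v :=
  (tendsto_const_nhds.congr' (h.mono fun _ ht => ht.symm)).limUnder_eq

end GMD

/-! ### The splitting of the minimal primes by dimension -/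

namespace GMD

variable {K : Type*} [Field K] {R : Type*} [CommRing R] [Algebra K R]
  {𝒜 : ℕ → Submodule K R} [GradedAlgebra 𝒜]

/-- The `q i` are the minimal primes of `R` of maximal dimension, the `p j` the remaining minimal
primes, both listed without repetition. -/
structure IsMinimalPrimeSplitting {a b : ℕ} (q : Fin a → Ideal R) (p : Fin b → Ideal R) :
    Prop where
  injective : Function.Injective (Sum.elim q p)
  range_eq : Set.range (Sum.elim q p) = minimalPrimes R
  dim_left : ∀ i, ringKrullDim (R ⧸ q i) = ringKrullDim R
  dim_right : ∀ j, ringKrullDim (R ⧸ p j) < ringKrullDim R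

namespace IsMinimalPrimeSplitting

variable {a b : ℕ} {q : Fin a → Ideal R} {p : Fin b → Ideal R}

theorem isHomogeneous (h : IsMinimalPrimeSplitting q p) (k : Fin a ⊕ Fin b) :
    (Sum.elim q p k).IsHomogeneous 𝒜 :=
  isHomogeneous_of_mem_minimalPrimes (h.range_eq ▸ Set.mem_range_self k)

theorem isPrime (h : IsMinimalPrimeSplitting q p) (k : Fin a ⊕ Fin b) :
    (Sum.elim q p k).IsPrime :=
  isPrime_of_range_eq_minimalPrimes h.range_eq k

theorem multQuot_left_pos (h : IsMinimalPrimeSplitting q p) (hstd : IsStandardGraded 𝒜)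
    (i : Fin a) : 0 < multQuot 𝒜 (q i) :=
  multQuot_pos hstd (h.isHomogeneous (.inl i)) (h.dim_left i)

theorem multQuot_right (h : IsMinimalPrimeSplitting q p) (hstd : IsStandardGraded 𝒜)
    (j : Fin b) : multQuot 𝒜 (p j) = 0 :=
  multQuot_eq_zero hstd (h.isHomogeneous (.inr j)) (h.dim_right j)

open Classical in
theorem multQuot_add_sum (h : IsMinimalPrimeSplitting q p) (hstd : IsStandardGraded 𝒜)
    [IsReduced R] {I : Ideal R} (hI : I.IsHomogeneous 𝒜) :
    multQuot 𝒜 I + ∑ i with ¬ I ≤ q i, multQuot 𝒜 (q i) = hsMultiplicity R 𝒜 := by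
  rw [← multQuot_add_sum_not_le hstd h.range_eq h.injective hI, Finset.sum_filter,
    Finset.sum_filter, Fintype.sum_sum_type]
  simp only [Sum.elim_inl, Sum.elim_inr, h.multQuot_right hstd, ite_self, Finset.sum_const_zero,
    add_zero]
  congr!

theorem hsMultiplicity_eq_sum (h : IsMinimalPrimeSplitting q p) (hstd : IsStandardGraded 𝒜)
    [IsReduced R] : hsMultiplicity R 𝒜 = ∑ i, multQuot 𝒜 (q i) := by
  classical
  rw [← h.multQuot_add_sum hstd (Ideal.IsHomogeneous.top 𝒜), multQuot_top hstd, zero_add,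
    Finset.filter_true_of_mem]
  intro i _ hi
  exact (h.isPrime (.inl i)).ne_top (top_le_iff.1 hi)

/-- Only a ring with a single minimal prime can have a minimal prime of dimension zero. -/
theorem one_le_ringKrullDim (h : IsMinimalPrimeSplitting q p) (hstd : IsStandardGraded 𝒜)
    {k l : Fin a ⊕ Fin b} (hkl : k ≠ l) : 1 ≤ ringKrullDim (R ⧸ Sum.elim q p k) := by
  by_contra hlt
  have := h.isPrime k
  exact hkl (eq_of_le_of_range_eq_minimalPrimes h.range_eq h.injective
    (le_of_ringKrullDim_quotient_lt_one hstd (h.isHomogeneous l) (h.isPrime l).ne_top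
      (h.isHomogeneous k) (not_le.1 hlt))).symm

theorem isUnmixed_iff (h : IsMinimalPrimeSplitting q p) [NeZero a] [IsReduced R]
    [IsNoetherianRing R] : IsUnmixed R ↔ IsEmpty (Fin b) := by
  rw [IsUnmixed, associatedPrimes_eq_minimalPrimes, ← h.range_eq]
  constructor
  · intro hu
    refine ⟨fun j => ?_⟩
    have := hu _ ⟨.inl 0, rfl⟩ _ ⟨.inr j, rfl⟩
    rw [Sum.elim_inl, Sum.elim_inr, h.dim_left] at this
    exact (h.dim_right j).ne this.symm
  · rintro hb _ ⟨k | j, rfl⟩ _ ⟨l | j', rfl⟩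
    · rw [Sum.elim_inl, Sum.elim_inl, h.dim_left, h.dim_left]
    · exact hb.elim j'
    · exact hb.elim j
    · exact hb.elim j

theorem isEmpty_of_ringKrullDim_eq_one (h : IsMinimalPrimeSplitting q p)
    (hstd : IsStandardGraded 𝒜) [NeZero a] (hd : ringKrullDim R = 1) : IsEmpty (Fin b) := by
  refine ⟨fun j => ?_⟩
  have h1 := h.one_le_ringKrullDim hstd (k := .inr j) (l := .inl 0) (by simp)
  exact absurd h1 (not_le.2 (hd ▸ h.dim_right j))

open Classical in
/-- To compute `δ(t, ℓ)` it suffices to minimize, over the admissible families, the total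
multiplicity of the top-dimensional components on which the family does not vanish. -/
theorem gmd_eq (h : IsMinimalPrimeSplitting q p) (hstd : IsStandardGraded 𝒜) [IsReduced R]
    {t ℓ : ℕ} {v : ℝ} {f₀ : Fin ℓ → R} (hf₀ : f₀ ∈ formFamilies 𝒜 t ℓ)
    (hle₀ : ∑ i with ¬ Ideal.span (Set.range f₀) ≤ q i, multQuot 𝒜 (q i) ≤ v)
    (hle : ∀ f ∈ formFamilies 𝒜 t ℓ,
      v ≤ ∑ i with ¬ Ideal.span (Set.range f) ≤ q i, multQuot 𝒜 (q i)) : gmd 𝒜 t ℓ = v :=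
  gmd_eq_of_forall_le (c := fun f => ∑ i with ¬ Ideal.span (Set.range f) ≤ q i, multQuot 𝒜 (q i))
    (fun _ hf => h.multQuot_add_sum hstd (isHomogeneous_span_range hf.1)) hf₀ hle₀ hle

/-! ### Stabilization values -/

theorem sum_multQuot_left_nonneg (h : IsMinimalPrimeSplitting q p) (hstd : IsStandardGraded 𝒜)
    (σ : Finset (Fin a)) : 0 ≤ ∑ i ∈ σ, multQuot 𝒜 (q i) :=
  Finset.sum_nonneg fun i _ => (h.multQuot_left_pos hstd i).le

/-- If admissible families vanish on all top-dimensional components, then `δ(t, ℓ) = 0`. -/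
theorem gmd_eq_zero (h : IsMinimalPrimeSplitting q p) (hstd : IsStandardGraded 𝒜) [IsReduced R]
    {t ℓ : ℕ} {f₀ : Fin ℓ → R} (hf₀ : f₀ ∈ formFamilies 𝒜 t ℓ)
    (hle₀ : ∀ i, Ideal.span (Set.range f₀) ≤ q i) : gmd 𝒜 t ℓ = 0 := by
  classical
  refine h.gmd_eq hstd hf₀ ?_ fun f _ => h.sum_multQuot_left_nonneg hstd _
  rw [Finset.filter_false_of_mem fun i _ => not_not.2 (hle₀ i), Finset.sum_empty]

/-- If `dim R/p j ≥ 2`, there are enough forms vanishing on every component except that of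
`p j`. -/
theorem eventually_gmd_eq_zero_of_two_le (h : IsMinimalPrimeSplitting q p)
    (hstd : IsStandardGraded 𝒜) [IsReduced R] [NeZero a] {j : Fin b}
    (hj : 2 ≤ ringKrullDim (R ⧸ p j)) (ℓ : ℕ) : ∀ᶠ t in atTop, gmd 𝒜 t ℓ = 0 := by
  filter_upwards [eventually_le_finrank_idealPiece hstd h.range_eq h.injective (i := .inr j) hj ℓ]
    with t ht
  obtain ⟨f, hf, hfS⟩ := exists_mem_formFamilies h.range_eq h.injective
    ⟨.inl 0, by simp⟩ ht
  exact h.gmd_eq_zero hstd hf fun i => hfS (.inl i) (by simp)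

omit [GradedAlgebra 𝒜] in
theorem gmd_eq_of_isDomain [IsDomain R] {ℓ : ℕ} (hℓ : 1 ≤ ℓ) (t : ℕ) :
    gmd 𝒜 t ℓ = hsMultiplicity R 𝒜 := by
  refine gmd_eq_of_forall_not_mem fun f hf => ?_
  obtain ⟨-, hli, hann⟩ := hf
  obtain ⟨r, hr, hr0⟩ := Submodule.exists_mem_ne_zero_of_ne_bot hann
  refine not_span_range_le_bot hℓ hli fun x hx => ?_
  exact (mul_eq_zero.1 (Submodule.mem_annihilator.1 hr x hx)).resolve_left hr0

theorem eq_bot_of_forall_eq (h : IsMinimalPrimeSplitting q p) [IsReduced R] [NeZero a]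
    (hk : ∀ k : Fin a ⊕ Fin b, k = .inl 0) : q 0 = ⊥ := by
  rw [eq_bot_iff]
  exact fun x hx => eq_zero_of_forall_mem_minimalPrimes h.range_eq fun k => hk k ▸ hx

theorem isDomain_of_forall_eq (h : IsMinimalPrimeSplitting q p) [IsReduced R] [NeZero a]
    (hk : ∀ k : Fin a ⊕ Fin b, k = .inl 0) : IsDomain R := by
  have h0 := h.isPrime (.inl 0)
  rw [Sum.elim_inl, h.eq_bot_of_forall_eq hk] at h0
  exact IsDomain.of_bot_isPrime R

/-- In dimension at least two, families vanishing on every component except that of `q 0` exist in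
all large degrees; they are optimal unless a family vanishes on every `q i`. -/
theorem eventually_gmd_eq_multQuot_zero (h : IsMinimalPrimeSplitting q p)
    (hstd : IsStandardGraded 𝒜) [IsReduced R] [NeZero a]
    (hmono : ∀ i j, i ≤ j → multQuot 𝒜 (q i) ≤ multQuot 𝒜 (q j))
    (hd : 2 ≤ ringKrullDim R) {k : Fin a ⊕ Fin b} (hk : k ≠ .inl 0) {ℓ : ℕ}
    (hne : ∀ᶠ t in atTop, ∀ f ∈ formFamilies 𝒜 t ℓ, ∃ i, ¬ Ideal.span (Set.range f) ≤ q i) :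
    ∀ᶠ t in atTop, gmd 𝒜 t ℓ = multQuot 𝒜 (q 0) := by
  classical
  filter_upwards [hne, eventually_le_finrank_idealPiece hstd h.range_eq h.injective
    (i := .inl 0) (hd.trans_eq (h.dim_left 0).symm) ℓ] with t hne ht
  obtain ⟨f, hf, hfS⟩ := exists_mem_formFamilies h.range_eq h.injective
    ⟨k, by simpa using hk⟩ ht
  refine h.gmd_eq hstd hf ?_ fun g hg => ?_
  · rw [← Finset.sum_singleton (fun i => multQuot 𝒜 (q i)) (0 : Fin a)]
    refine Finset.sum_le_sum_of_subset_of_nonneg (fun i hi => ?_)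
      fun i _ _ => (h.multQuot_left_pos hstd i).le
    rw [Finset.mem_singleton]
    by_contra hi0
    exact (Finset.mem_filter.1 hi).2 (hfS (.inl i) (by simpa using hi0))
  · obtain ⟨i, hi⟩ := hne g hg
    exact (hmono 0 i (Fin.zero_le i)).trans
      (Finset.single_le_sum (f := fun i => multQuot 𝒜 (q i))
        (fun i _ => (h.multQuot_left_pos hstd i).le) (by simpa using hi))

open Classical in
/-- In dimension one, the sets of components on which admissible families of `ℓ` forms of large
degree do not vanish are, up to shrinking, the proper sets of total multiplicity at least `ℓ`. -/
theorem eventually_formFamilies_of_ringKrullDim_eq_one (h : IsMinimalPrimeSplitting q p)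
    (hstd : IsStandardGraded 𝒜) [IsReduced R] [NeZero a] (hd : ringKrullDim R = 1) (ℓ : ℕ) :
    ∀ᶠ t in atTop,
      (∀ f ∈ formFamilies 𝒜 t ℓ, ({i | ¬ Ideal.span (Set.range f) ≤ q i} : Finset (Fin a)) ⊂
          Finset.univ ∧
        (ℓ : ℝ) ≤ ∑ i with ¬ Ideal.span (Set.range f) ≤ q i, multQuot 𝒜 (q i)) ∧
      ∀ σ : Finset (Fin a), σ ⊂ Finset.univ → (ℓ : ℝ) ≤ ∑ i ∈ σ, multQuot 𝒜 (q i) →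
        ∃ f ∈ formFamilies 𝒜 t ℓ, ({i | ¬ Ideal.span (Set.range f) ≤ q i} : Finset (Fin a)) ⊆
          σ := by
  have hb := h.isEmpty_of_ringKrullDim_eq_one hstd hd
  have hall : ∀ᶠ t in atTop, ∀ σ : Finset (Fin a),
      (Module.finrank K (idealPiece 𝒜 ((σ.map Function.Embedding.inl)ᶜ.inf (Sum.elim q p)) t) : ℝ) =
        ∑ i ∈ σ, multQuot 𝒜 (q i) := by
    refine eventually_all.2 fun σ => ?_
    have := eventually_finrank_idealPiece_eq_sum hstd h.range_eq h.injective hd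
      (σ.map (Function.Embedding.inl (β := Fin b)))ᶜ
    rw [compl_compl, Finset.sum_map] at this
    exact this
  filter_upwards [hall] with t ht
  refine ⟨fun f hf => ?_, fun σ hσ hℓ => ?_⟩
  · obtain ⟨hft, hli, k, hk⟩ := (mem_formFamilies_iff h.range_eq h.injective).1 hf
    obtain ⟨i, rfl⟩ : ∃ i, k = .inl i := by
      rcases k with i | j
      · exact ⟨i, rfl⟩
      · exact hb.elim j
    constructor
    · rw [Finset.ssubset_univ_iff]
      intro hu
      exact (Finset.mem_filter.1 (Finset.eq_univ_iff_forall.1 hu i)).2 hk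
    · rw [← ht]
      refine Nat.cast_le.2 (le_finrank_idealPiece hstd.finite hft hli ?_)
      rw [Finset.le_inf_iff]
      rintro (l | j) hl
      · simpa using hl
      · exact hb.elim j
  · obtain ⟨i, hi⟩ : ∃ i, i ∉ σ := by
      by_contra! hcon
      exact hσ.ne (Finset.eq_univ_iff_forall.2 hcon)
    rw [← ht, Nat.cast_le] at hℓ
    obtain ⟨f, hf, hfS⟩ := exists_mem_formFamilies h.range_eq h.injective
      ⟨.inl i, by simpa using hi⟩ hℓ
    refine ⟨f, hf, fun l hl => ?_⟩
    by_contra hlσ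
    exact (Finset.mem_filter.1 hl).2 (hfS (.inl l) (by simpa using hlσ))

/-- In dimension one with `ℓ ≤ e(R) - e(R/q 0)`, the complement of `q 0` is a proper set of
components of multiplicity at least `ℓ`, so the minimum in question is taken over a nonempty set. -/
theorem exists_isLeast_and_eventually_gmd_eq (h : IsMinimalPrimeSplitting q p)
    (hstd : IsStandardGraded 𝒜) [IsReduced R] [NeZero a] (hd : ringKrullDim R = 1) {ℓ : ℕ}
    (hℓ : (ℓ : ℝ) ≤ hsMultiplicity R 𝒜 - multQuot 𝒜 (q 0)) :
    ∃ v, IsLeast {x : ℝ | ∃ σ : Finset (Fin a), σ ⊂ Finset.univ ∧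
          (ℓ : ℝ) ≤ ∑ i ∈ σ, multQuot 𝒜 (q i) ∧ x = ∑ i ∈ σ, multQuot 𝒜 (q i)} v ∧
      ∀ᶠ t in atTop, gmd 𝒜 t ℓ = v := by
  classical
  obtain ⟨σ, hσ, hmin⟩ := Finset.exists_min_image
    ({σ | σ ⊂ Finset.univ ∧ (ℓ : ℝ) ≤ ∑ i ∈ σ, multQuot 𝒜 (q i)} : Finset (Finset (Fin a)))
    (fun σ => ∑ i ∈ σ, multQuot 𝒜 (q i)) ⟨Finset.univ.erase 0, by
      rw [Finset.mem_filter]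
      refine ⟨Finset.mem_univ _, Finset.erase_ssubset (Finset.mem_univ 0), ?_⟩
      rw [h.hsMultiplicity_eq_sum hstd, ← Finset.add_sum_erase _ _ (Finset.mem_univ (0 : Fin a)),
        add_sub_cancel_left] at hℓ
      exact hℓ⟩
  obtain ⟨-, hσu, hσℓ⟩ := Finset.mem_filter.1 hσ
  refine ⟨_, ⟨⟨σ, hσu, hσℓ, rfl⟩, ?_⟩, ?_⟩
  · rintro _ ⟨τ, hτu, hτℓ, rfl⟩
    exact hmin τ (Finset.mem_filter.2 ⟨Finset.mem_univ _, hτu, hτℓ⟩)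
  · filter_upwards [h.eventually_formFamilies_of_ringKrullDim_eq_one hstd hd ℓ] with t ht
    obtain ⟨f, hf, hfσ⟩ := ht.2 σ hσu hσℓ
    refine h.gmd_eq hstd hf (Finset.sum_le_sum_of_subset_of_nonneg hfσ
      fun i _ _ => (h.multQuot_left_pos hstd i).le) fun g hg => ?_
    exact hmin _ (Finset.mem_filter.2 ⟨Finset.mem_univ _, ht.1 g hg⟩)

/-- In dimension one with `ℓ > e(R) - e(R/q 0)`, every proper set of components has multiplicity
less than `ℓ`, so there are no admissible families of large degree. -/
theorem eventually_gmd_eq_hsMultiplicity (h : IsMinimalPrimeSplitting q p)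
    (hstd : IsStandardGraded 𝒜) [IsReduced R] [NeZero a]
    (hmono : ∀ i j, i ≤ j → multQuot 𝒜 (q i) ≤ multQuot 𝒜 (q j))
    (hd : ringKrullDim R = 1) {ℓ : ℕ}
    (hℓ : hsMultiplicity R 𝒜 - multQuot 𝒜 (q 0) < (ℓ : ℝ)) :
    ∀ᶠ t in atTop, gmd 𝒜 t ℓ = hsMultiplicity R 𝒜 := by
  classical
  filter_upwards [h.eventually_formFamilies_of_ringKrullDim_eq_one hstd hd ℓ] with t ht
  refine gmd_eq_of_forall_not_mem fun f hf => ?_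
  obtain ⟨hu, hle⟩ := ht.1 f hf
  obtain ⟨i, -, hi⟩ := Finset.exists_of_ssubset hu
  have h1 : ∑ l with ¬ Ideal.span (Set.range f) ≤ q l, multQuot 𝒜 (q l) ≤
      ∑ l ∈ Finset.univ.erase i, multQuot 𝒜 (q l) :=
    Finset.sum_le_sum_of_subset_of_nonneg
      (fun l hl => Finset.mem_erase.2 ⟨fun hli => hi (hli ▸ hl), Finset.mem_univ l⟩)
      fun l _ _ => (h.multQuot_left_pos hstd l).le
  have h2 := Finset.add_sum_erase _ (fun l => multQuot 𝒜 (q l)) (Finset.mem_univ i)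
  have h3 := hmono 0 i (Fin.zero_le i)
  rw [h.hsMultiplicity_eq_sum hstd] at hℓ
  linarith

/-- When every `R/p j` has dimension one, the space of forms of degree `t ≫ 0` in `⋂ q i` has
dimension `e_T(T)`, with `T = R/⋂ p j`. -/
theorem eventually_finrank_idealPiece_inf_left (h : IsMinimalPrimeSplitting q p)
    (hstd : IsStandardGraded 𝒜) [IsReduced R] [Nonempty (Fin b)]
    (hp : ∀ j, ringKrullDim (R ⧸ p j) = 1) :
    ∀ᶠ t in atTop, (Module.finrank K (idealPiece 𝒜 ((Finset.univ.map
      Function.Embedding.inl).inf (Sum.elim q p)) t) : ℝ) = multSelfQuot 𝒜 (⨅ j, p j) := by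
  classical
  set S : Finset (Fin a ⊕ Fin b) := Finset.univ.map Function.Embedding.inl
  have hSc : Sᶜ.inf (Sum.elim q p) = ⨅ j, p j := by
    have : Sᶜ = Finset.univ.map Function.Embedding.inr := by
      ext (i | j) <;> simp [S]
    rw [this, Finset.inf_map, Finset.inf_univ_eq_iInf]
    rfl
  have hS := isHomogeneous_inf (𝒜 := 𝒜) h.isHomogeneous S
  have hT := isHomogeneous_inf (𝒜 := 𝒜) h.isHomogeneous Sᶜ
  have hST := inf_compl_inf_eq_bot h.range_eq S
  have hnot := not_inf_sup_compl_inf_le h.range_eq h.injective S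
  have hex : ∀ Q : Ideal R, Q.IsPrime → Sᶜ.inf (Sum.elim q p) ≤ Q → ∃ j, p j ≤ Q := by
    intro Q hQ hle
    obtain ⟨i | j, hk, hkQ⟩ := hQ.inf_le'.1 hle
    · simp [S] at hk
    · exact ⟨j, hkQ⟩
  have hlt : ringKrullDim (R ⧸ (S.inf (Sum.elim q p) ⊔ Sᶜ.inf (Sum.elim q p))) < 1 := by
    refine ringKrullDim_quotient_lt_of_forall_prime (n := 1) fun Q hQ hle => ?_
    obtain ⟨j, hj⟩ := hex Q hQ (le_sup_right.trans hle)
    have : (p j).IsPrime := h.isPrime (.inr j)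
    exact ringKrullDim_quotient_lt_of_lt
      (lt_of_le_of_ne hj fun hjQ => hnot (.inr j) (by rw [Sum.elim_inr, hjQ]; exact hle))
      (hp j).le
  have hdim : ringKrullDim (R ⧸ Sᶜ.inf (Sum.elim q p)) = 1 := by
    apply le_antisymm
    · have hlt2 : ringKrullDim (R ⧸ Sᶜ.inf (Sum.elim q p)) < (2 : ℕ) := by
        refine ringKrullDim_quotient_lt_of_forall_prime fun Q hQ hle => ?_
        obtain ⟨j, hj⟩ := hex Q hQ hle
        refine (ringKrullDim_le_of_surjective (Ideal.Quotient.factor hj)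
          (Ideal.Quotient.factor_surjective hj)).trans_lt ?_
        rw [hp j]
        norm_num
      have htop : Sᶜ.inf (Sum.elim q p) ≠ ⊤ := fun htop => by
        have hle : S.inf (Sum.elim q p) = ⊥ := by rwa [htop, inf_top_eq] at hST
        obtain ⟨j⟩ := ‹Nonempty (Fin b)›
        have := exists_mem_le_of_inf_le h.range_eq h.injective
          (hle.le.trans (bot_le (a := Sum.elim q p (.inr j))))
        simp [S] at this
      obtain ⟨D, hD⟩ := hstd.exists_ringKrullDim_eq hT htop
      rw [hD] at hlt2 ⊢
      have : D < 2 := by exact_mod_cast hlt2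
      exact_mod_cast Nat.lt_succ_iff.1 this
    · obtain ⟨j⟩ := ‹Nonempty (Fin b)›
      have hj : Sᶜ.inf (Sum.elim q p) ≤ p j := Finset.inf_le (f := Sum.elim q p) (b := .inr j)
        (by simp [S])
      rw [← hp j]
      exact ringKrullDim_le_of_surjective (Ideal.Quotient.factor hj)
        (Ideal.Quotient.factor_surjective hj)
  obtain ⟨L, hL, -⟩ := exists_tendsto_cumHilbert hstd hT (d := 1) hdim.le
  rw [← hSc, multSelfQuot_eq_of_tendsto (d := 1) hdim hL]
  exact eventually_finrank_idealPiece_eq hstd hS hT hST hlt hdim.le hL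

theorem eventually_gmd_eq_zero_of_le (h : IsMinimalPrimeSplitting q p)
    (hstd : IsStandardGraded 𝒜) [IsReduced R] [NeZero a] [Nonempty (Fin b)]
    (hp : ∀ j, ringKrullDim (R ⧸ p j) = 1) {ℓ : ℕ}
    (hℓ : (ℓ : ℝ) ≤ multSelfQuot 𝒜 (⨅ j, p j)) : ∀ᶠ t in atTop, gmd 𝒜 t ℓ = 0 := by
  filter_upwards [h.eventually_finrank_idealPiece_inf_left hstd hp] with t ht
  rw [← ht, Nat.cast_le] at hℓ
  obtain ⟨f, hf, hfS⟩ := exists_mem_formFamilies h.range_eq h.injective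
    ⟨.inl 0, by simp⟩ hℓ
  exact h.gmd_eq_zero hstd hf fun i => hfS (.inl i) (by simp)

/-- If `ℓ > e_T(T)`, then in large degrees `⋂ q i` contains fewer than `ℓ` independent forms, so
every admissible family misses some `q i`. -/
theorem eventually_gmd_eq_multQuot_zero_of_lt (h : IsMinimalPrimeSplitting q p)
    (hstd : IsStandardGraded 𝒜) [IsReduced R] [NeZero a] [Nonempty (Fin b)]
    (hmono : ∀ i j, i ≤ j → multQuot 𝒜 (q i) ≤ multQuot 𝒜 (q j))
    (hp : ∀ j, ringKrullDim (R ⧸ p j) = 1) {ℓ : ℕ}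
    (hℓ : multSelfQuot 𝒜 (⨅ j, p j) < (ℓ : ℝ)) :
    ∀ᶠ t in atTop, gmd 𝒜 t ℓ = multQuot 𝒜 (q 0) := by
  obtain ⟨j⟩ := ‹Nonempty (Fin b)›
  have hd : 2 ≤ ringKrullDim R := by
    obtain ⟨d, hd⟩ := hstd.ringKrullDim_eq
    have hlt := h.dim_right j
    rw [hp j, hd] at hlt
    rw [hd]
    have : 1 < d := by exact_mod_cast hlt
    exact_mod_cast this
  have : Nonempty (Fin b) := ⟨j⟩
  refine h.eventually_gmd_eq_multQuot_zero hstd hmono hd (k := .inr j) (by simp) ?_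
  filter_upwards [h.eventually_finrank_idealPiece_inf_left hstd hp] with t ht f hf
  by_contra! hcon
  have hle := le_finrank_idealPiece hstd.finite hf.1 hf.2.1 (I := (Finset.univ.map
    Function.Embedding.inl).inf (Sum.elim q p)) (by
      rw [Finset.le_inf_iff]
      rintro (i | j) hk
      · exact hcon i
      · simp at hk)
  rw [← ht, Nat.cast_lt] at hℓ
  omega

/-- Without lower-dimensional components, a family vanishing on every component is zero. -/
theorem eventually_gmd_eq_multQuot_zero_of_isEmpty (h : IsMinimalPrimeSplitting q p)
    (hstd : IsStandardGraded 𝒜) [IsReduced R] [NeZero a]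
    (hmono : ∀ i j, i ≤ j → multQuot 𝒜 (q i) ≤ multQuot 𝒜 (q j))
    (hb : IsEmpty (Fin b)) (hd : 2 ≤ ringKrullDim R) {ℓ : ℕ} (hℓ : 1 ≤ ℓ) :
    ∀ᶠ t in atTop, gmd 𝒜 t ℓ = multQuot 𝒜 (q 0) := by
  by_cases hk : ∃ k : Fin a ⊕ Fin b, k ≠ .inl 0
  · obtain ⟨k, hk⟩ := hk
    refine h.eventually_gmd_eq_multQuot_zero hstd hmono hd hk (.of_forall fun t f hf => ?_)
    by_contra! hcon
    refine not_span_range_le_bot hℓ hf.2.1 fun x hx => ?_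
    refine eq_zero_of_forall_mem_minimalPrimes h.range_eq ?_
    rintro (i | j)
    · exact hcon i hx
    · exact hb.elim j
  · push Not at hk
    have := h.isDomain_of_forall_eq hk
    rw [h.eq_bot_of_forall_eq hk, ← hsMultiplicity_eq_multQuot_bot]
    exact .of_forall fun t => gmd_eq_of_isDomain hℓ t

theorem exists_eventually_gmd_eq (h : IsMinimalPrimeSplitting q p)
    (hstd : IsStandardGraded 𝒜) [IsReduced R] [NeZero a]
    (hmono : ∀ i j, i ≤ j → multQuot 𝒜 (q i) ≤ multQuot 𝒜 (q j)) {ℓ : ℕ} (hℓ : 1 ≤ ℓ) :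
    ∃ v, ∀ᶠ t in atTop, gmd 𝒜 t ℓ = v := by
  rcases isEmpty_or_nonempty (Fin b) with hb | hb
  · by_cases hk : ∃ k : Fin a ⊕ Fin b, k ≠ .inl 0
    · obtain ⟨k, hk⟩ := hk
      have h1 := h.one_le_ringKrullDim hstd hk.symm
      rw [Sum.elim_inl, h.dim_left] at h1
      rcases h1.eq_or_lt with hd | hd
      · rcases le_or_gt (ℓ : ℝ) (hsMultiplicity R 𝒜 - multQuot 𝒜 (q 0)) with hle | hlt
        · obtain ⟨v, -, hv⟩ := h.exists_isLeast_and_eventually_gmd_eq hstd hd.symm hle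
          exact ⟨v, hv⟩
        · exact ⟨_, h.eventually_gmd_eq_hsMultiplicity hstd hmono hd.symm hlt⟩
      · refine ⟨_, h.eventually_gmd_eq_multQuot_zero_of_isEmpty hstd hmono hb ?_ hℓ⟩
        obtain ⟨d, hd'⟩ := hstd.ringKrullDim_eq
        rw [hd'] at hd ⊢
        have : 1 < d := by exact_mod_cast hd
        exact_mod_cast this
    · push Not at hk
      have := h.isDomain_of_forall_eq hk
      exact ⟨_, .of_forall fun t => gmd_eq_of_isDomain hℓ t⟩
  · by_cases hj : ∃ j, 2 ≤ ringKrullDim (R ⧸ p j)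
    · obtain ⟨j, hj⟩ := hj
      exact ⟨0, h.eventually_gmd_eq_zero_of_two_le hstd hj ℓ⟩
    · push Not at hj
      have hp : ∀ j, ringKrullDim (R ⧸ p j) = 1 := fun j => by
        have h1 : 1 ≤ ringKrullDim (R ⧸ p j) :=
          h.one_le_ringKrullDim hstd (k := .inr j) (l := .inl 0) (by simp)
        have h2 := hj j
        obtain ⟨D, hD⟩ := hstd.exists_ringKrullDim_eq (h.isHomogeneous (.inr j))
          (h.isPrime (.inr j)).ne_top
        rw [Sum.elim_inr] at hD
        rw [hD] at h1 h2 ⊢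
        have h1' : 1 ≤ D := by exact_mod_cast h1
        have h2' : D < 2 := by exact_mod_cast h2
        exact_mod_cast (by omega : D = 1)
      rcases le_or_gt (ℓ : ℝ) (multSelfQuot 𝒜 (⨅ j, p j)) with hle | hlt
      · exact ⟨0, h.eventually_gmd_eq_zero_of_le hstd hp hle⟩
      · exact ⟨_, h.eventually_gmd_eq_multQuot_zero_of_lt hstd hmono hp hlt⟩

end IsMinimalPrimeSplitting

end GMD

theorem mainTheorem2 {K : Type*} [Field K] {R : Type*} [CommRing R] [Algebra K R] [IsReduced R]
    (𝒜 : ℕ → Submodule K R) [GradedAlgebra 𝒜] (hstd : GMD.IsStandardGraded 𝒜)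
    (a b : ℕ) [NeZero a] (q : Fin a → Ideal R) (p : Fin b → Ideal R)
    (hinj : Function.Injective (Sum.elim q p))
    (hmin : Set.range (Sum.elim q p) = minimalPrimes R)
    (hq : ∀ i, ringKrullDim (R ⧸ q i) = ringKrullDim R)
    (hp : ∀ j, ringKrullDim (R ⧸ p j) < ringKrullDim R)
    (hmono : ∀ i j, i ≤ j → GMD.multQuot 𝒜 (q i) ≤ GMD.multQuot 𝒜 (q j))
    (ℓ : ℕ) (hℓ : 1 ≤ ℓ) :
    -- the GMD function stabilizes, so that its limit is meaningful
    (∀ᶠ t in atTop, GMD.gmd 𝒜 t ℓ = GMD.stabilizationValue 𝒜 ℓ) ∧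
    (¬ GMD.IsUnmixed R → (∃ j, 2 ≤ ringKrullDim (R ⧸ p j)) →
      GMD.stabilizationValue 𝒜 ℓ = 0) ∧
    (IsDomain R → GMD.stabilizationValue 𝒜 ℓ = GMD.hsMultiplicity R 𝒜) ∧
    (GMD.IsUnmixed R → 2 ≤ ringKrullDim R →
      GMD.stabilizationValue 𝒜 ℓ = GMD.multQuot 𝒜 (q 0)) ∧
    (ringKrullDim R = 1 → (ℓ : ℝ) ≤ GMD.hsMultiplicity R 𝒜 - GMD.multQuot 𝒜 (q 0) →
      IsLeast {x : ℝ | ∃ σ : Finset (Fin a), σ ⊂ Finset.univ ∧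
          (ℓ : ℝ) ≤ ∑ i ∈ σ, GMD.multQuot 𝒜 (q i) ∧ x = ∑ i ∈ σ, GMD.multQuot 𝒜 (q i)}
        (GMD.stabilizationValue 𝒜 ℓ)) ∧
    (ringKrullDim R = 1 → GMD.hsMultiplicity R 𝒜 - GMD.multQuot 𝒜 (q 0) < (ℓ : ℝ) →
      GMD.stabilizationValue 𝒜 ℓ = GMD.hsMultiplicity R 𝒜) ∧
    (¬ GMD.IsUnmixed R → (∀ j, ringKrullDim (R ⧸ p j) = 1) →
      (ℓ : ℝ) ≤ GMD.multSelfQuot 𝒜 (⨅ j, p j) →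
      GMD.stabilizationValue 𝒜 ℓ = 0) ∧
    (¬ GMD.IsUnmixed R → (∀ j, ringKrullDim (R ⧸ p j) = 1) →
      GMD.multSelfQuot 𝒜 (⨅ j, p j) < (ℓ : ℝ) →
      GMD.stabilizationValue 𝒜 ℓ = GMD.multQuot 𝒜 (q 0)) := by
  have h : GMD.IsMinimalPrimeSplitting q p := ⟨hinj, hmin, hq, hp⟩
  have := hstd.isNoetherianRing
  have hb : ¬ GMD.IsUnmixed R → Nonempty (Fin b) := fun hu =>
    not_isEmpty_iff.1 (mt h.isUnmixed_iff.2 hu)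
  refine ⟨?_, ?_, ?_, ?_, ?_, ?_, ?_, ?_⟩
  · obtain ⟨v, hv⟩ := h.exists_eventually_gmd_eq hstd hmono hℓ
    rwa [GMD.stabilizationValue_eq hv]
  · rintro - ⟨j, hj⟩
    exact GMD.stabilizationValue_eq (h.eventually_gmd_eq_zero_of_two_le hstd hj ℓ)
  · intro hdom
    exact GMD.stabilizationValue_eq
      (.of_forall fun t => GMD.IsMinimalPrimeSplitting.gmd_eq_of_isDomain hℓ t)
  · intro hu hd
    exact GMD.stabilizationValue_eq (h.eventually_gmd_eq_multQuot_zero_of_isEmpty hstd hmono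
      (h.isUnmixed_iff.1 hu) hd hℓ)
  · intro hd hle
    obtain ⟨v, hv, hev⟩ := h.exists_isLeast_and_eventually_gmd_eq hstd hd hle
    rwa [GMD.stabilizationValue_eq hev]
  · intro hd hlt
    exact GMD.stabilizationValue_eq (h.eventually_gmd_eq_hsMultiplicity hstd hmono hd hlt)
  · intro hu hp1 hle
    have := hb hu
    exact GMD.stabilizationValue_eq (h.eventually_gmd_eq_zero_of_le hstd hp1 hle)
  · intro hu hp1 hlt
    have := hb hu
    exact GMD.stabilizationValue_eq
      (h.eventually_gmd_eq_multQuot_zero_of_lt hstd hmono hp1 hlt)
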